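/- Let $a,b>0$, and in the plane put $\mathcal D=\{x=a,\ 0<y<b\}$, $A_0=\mathcal D\cup\{0<x<a\}$, $B_0=\mathcal D\cup\{x>a\}$, $A_1=A_0\cap\{y>0\}$, $B_1=B_0\cap\{y>0\}$, $B_2=B_0\cap\{y<b\}$, $B_3=B_0\cap\{0<y<b\}$. For $i\in\{0,1\}$ and $j\in\{0,1,2,3\}$ let $C_{ij}=A_i\cup B_j$, and let $\mathcal R_{ij}$ be the set of all open rectangles $R$ in the plane for which there is a continuous path $(\Phi_t)_{t\in[0,1]}$ in the Euclidean group $E(2)$ with $\Phi_0(R)\subset A_i$, $\Phi_1(R)\subset B_j$ and $\Phi_t(R)\subset C_{ij}$ for all $t\in[0,1]$. Put $l=\sqrt{a^2+b^2}$ and $h=ab/\sqrt{a^2+b^2}$. For all $i,j$, the maximum area of a rectangle in $\mathcal R_{ij}$ exists and equals $ab$. Moreover: (i) for $j=0,1,2$, the rectangles of maximum area in $\mathcal R_{0j}$ are exactly the open rectangles with side lengths $ab/d$ and $d$, where $0<d\le\min\{a,b\}$; (ii) the rectangles of maximum area in $\mathcal R_{03}$ are exactly the open rectangles with side lengths $ab/d$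 and $d$, where $h\le d\le\min\{a,b\}$; (iii) for $j=0,2$, the rectangles of maximum area in $\mathcal R_{1j}$ are exactly the open rectangles with side lengths $a$ and $b$, and those with side lengths $ab/d$ and $d$, where $0<d\le h$; (iv) for $j=1,3$, the rectangles of maximum area in $\mathcal R_{1j}$ are exactly the open rectangles with side lengths $a$ and $b$, and those with side lengths $l$ and $h$. -/

import Mathlib

open MeasureTheory

/-- The Euclidean plane; the coordinates of `p` are `x = p 0` and `y = p 1`. -/
abbrev Plane : Type := EuclideanSpace ℝ (Fin 2)

/-- Elements of the Euclidean group `E(2)`. -/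
abbrev RigidMotion : Type := Plane ≃ᵃⁱ[ℝ] Plane

/-- The open box `(0, c) × (0, d)`. -/
def openBox (c d : ℝ) : Set Plane :=
  {p | 0 < p 0 ∧ p 0 < c ∧ 0 < p 1 ∧ p 1 < d}

/-- `R` is an open (nondegenerate) rectangle with side lengths `c` and `d`, in any position. -/
def IsOpenRectangle (R : Set Plane) (c d : ℝ) : Prop :=
  0 < c ∧ 0 < d ∧ ∃ g : RigidMotion, R = g '' openBox c d

/-- The door `D`: the open segment `x = a`, `0 < y < b`. -/
def door (a b : ℝ) : Set Plane :=
  {p | p 0 = a ∧ 0 < p 1 ∧ p 1 < b}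

/-- `A₀ = D ∪ {0 < x < a}`. -/
def corridorA0 (a b : ℝ) : Set Plane :=
  door a b ∪ {p | 0 < p 0 ∧ p 0 < a}

/-- `B₀ = D ∪ {x > a}`. -/
def corridorB0 (a b : ℝ) : Set Plane :=
  door a b ∪ {p | a < p 0}

/-- The starting parts `A₀` and `A₁ = A₀ ∩ {y > 0}`. -/
def corridorA (a b : ℝ) : Fin 2 → Set Plane
  | 0 => corridorA0 a b
  | 1 => corridorA0 a b ∩ {p | 0 < p 1}

/-- The final parts `B₀`, `B₁ = B₀ ∩ {y > 0}`, `B₂ = B₀ ∩ {y < b}`, `B₃ = B₀ ∩ {0 < y < b}`. -/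
def corridorB (a b : ℝ) : Fin 4 → Set Plane
  | 0 => corridorB0 a b
  | 1 => corridorB0 a b ∩ {p | 0 < p 1}
  | 2 => corridorB0 a b ∩ {p | p 1 < b}
  | 3 => corridorB0 a b ∩ {p | 0 < p 1 ∧ p 1 < b}

/-- The corridor `C i j = A i ∪ B j`. -/
def corridor (a b : ℝ) (i : Fin 2) (j : Fin 4) : Set Plane :=
  corridorA a b i ∪ corridorB a b j

/-- `R` can be moved from `A` to `B` inside `C` by a path of rigid motions. The path is continuous
for the usual topology of `E(2)`, that is, `(t, p) ↦ Φ t p` is jointly continuous. -/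
def CanMove (R A B C : Set Plane) : Prop :=
  ∃ Φ : unitInterval → RigidMotion,
    (Continuous fun q : unitInterval × Plane => Φ q.1 q.2) ∧
    Φ 0 '' R ⊆ A ∧ Φ 1 '' R ⊆ B ∧ ∀ t, Φ t '' R ⊆ C

/-- The set of open rectangles that can move around the corner in the corridor `C i j`. -/
def movableRectangles (a b : ℝ) (i : Fin 2) (j : Fin 4) : Set (Set Plane) :=
  {R | (∃ c d : ℝ, IsOpenRectangle R c d) ∧
    CanMove R (corridorA a b i) (corridorB a b j) (corridor a b i j)}

/-- The rectangles of maximum area among those that can move around the corner in `C i j`. -/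
def maxAreaRectangles (a b : ℝ) (i : Fin 2) (j : Fin 4) : Set (Set Plane) :=
  {R | R ∈ movableRectangles a b i j ∧
    ∀ S ∈ movableRectangles a b i j, volume S ≤ volume R}

/-! Let the sides be `L = 2p` and `d = 2q`, with `c = |cos|` and `s = |sin|` of the tilt of the
sides `L`.

Upper bound. Where the line `x = a` crosses both sides of length `L`, its section has length `d / c`
and must fit the door, so `d ≤ b c`. At the moment when only the triangle at the leading corner is
past the door, a side of length `L` ends on the door line while the left wall bounds its other end,
so `L c ≤ a`. Multiplying gives `L d ≤ a b`. A steep crossing is treated with the two sides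
exchanged (`BoxMotion.exists_blocking`, `BoxMotion.area_le`).

Obstructions. If `L d = a b` and `L > a, b`, both bounds are equalities at the critical moment
(`BoxSat.critical`), which fixes the tilt: `b c = d`, `L c = a`. Let `G` be the signed protrusion
near that moment. Floors and ceilings next to the door give `d + G s ≤ b c`, the left wall gives `L
c ≤ a + G`, and together they give `G (a s - d) ≤ 0` (`BoxMotion.protrusion_mul_nonpos`). At the
critical tilt, `a s - d` has the sign of `h - d`. Right after the last critical moment `G > 0`,
which can exclude `d < h`; right before the first one `G < 0`, which can exclude `d > h`. The other
direction of tilt is excluded either by the same inequality or by a strict one that already fails at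
the critical moment.

Constructions. Clockwise turns along the two axes, turns pinned at the lower end of the door, and a
slide at the critical tilt realise all remaining cases. With `L d = a b`, their clearances factor as
`(b c - d)(d - a s)` and `(d - b c)(a - d s)` up to the factor `d` (`corner_bound`, `door_bound`).
-/

/-- The open box with centre `(X, Y)`, half sides `p`, `q` and axes `(c, τ)`, `(-τ, c)` satisfies
the pointwise condition `P`. -/
def BoxSat (p q X Y c τ : ℝ) (P : ℝ → ℝ → Prop) : Prop :=
  ∀ α β : ℝ, |α| < p → |β| < q → P (X + α * c - β * τ) (Y + α * τ + β * c)

/-- The conditions that hold in every corridor. -/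
def CorridorCond (a b x y : ℝ) : Prop := 0 < x ∧ (x = a → 0 < y ∧ y < b)

/-! ### Constraints on a single position of the box. -/

theorem nonneg_of_forall_lt_one_nonneg {A B : ℝ}
    (h : ∀ k : ℝ, 0 ≤ k → k < 1 → 0 ≤ A + k * (B - A)) : 0 ≤ B := by
  by_contra hB
  push Not at hB
  have hA : 0 ≤ A := by simpa using h 0 le_rfl one_pos
  have hAB : 0 < A - B := by linarith
  have h1 : A / (A - B) < 1 := by rw [div_lt_one hAB]; linarith
  have h0 : 0 ≤ A / (A - B) := by positivity
  -- Midway between the zero `A / (A - B)` of the interpolation and `1`, where it is already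
  -- negative.
  have := h ((A / (A - B) + 1) / 2) (by linarith) (by linarith)
  have h2 : A / (A - B) * (A - B) = A := div_mul_cancel₀ _ hAB.ne'
  nlinarith

theorem nonneg_of_forall_lt_one {A B : ℝ} (h : ∀ k : ℝ, 0 ≤ k → k < 1 → 0 < A + k * (B - A)) :
    0 ≤ B :=
  nonneg_of_forall_lt_one_nonneg fun k h0 h1 => (h k h0 h1).le

theorem abs_interpolate_lt {p α₀ α k : ℝ} (h0 : |α₀| < p) (h : |α| ≤ p) (hk0 : 0 ≤ k)
    (hk : k < 1) : |α₀ + k * (α - α₀)| < p := by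
  rw [abs_lt] at *
  rw [abs_le] at h
  constructor <;> nlinarith

/-- The strict condition on the abscissa persists on a segment from a suitable interior point to the
boundary point, so the bound on the ordinate passes to the limit. -/
theorem BoxSat.closed_of_lt {p q X Y c τ a A B C : ℝ} (hp : 0 < p) (hq : 0 < q)
    (h : BoxSat p q X Y c τ fun x y => A * x < a → 0 < B * y + C) {α β : ℝ}
    (hα : |α| ≤ p) (hβ : |β| ≤ q) (hx : A * (X + α * c - β * τ) < a) :
    0 ≤ B * (Y + α * τ + β * c) + C := by
  -- move the reference point close enough to `(α, β)` to satisfy the strict inequality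
  set x := X + α * c - β * τ with hxdef
  obtain ⟨m, hm0, hm1, hm⟩ : ∃ m : ℝ, 0 ≤ m ∧ m < 1 ∧
      A * (X + m * α * c - m * β * τ) < a := by
    by_cases h0 : A * X < a
    · exact ⟨0, le_rfl, one_pos, by simpa using h0⟩
    · push Not at h0
      have hpos : 0 < A * X - A * x := by linarith
      refine ⟨((A * X - a) / (A * X - A * x) + 1) / 2, ?_, ?_, ?_⟩
      · have : 0 ≤ (A * X - a) / (A * X - A * x) := div_nonneg (by linarith) hpos.le
        linarith
      · have : (A * X - a) / (A * X - A * x) < 1 := by rw [div_lt_one hpos]; linarith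
        linarith
      · have e : A * (X + ((A * X - a) / (A * X - A * x) + 1) / 2 * α * c -
            ((A * X - a) / (A * X - A * x) + 1) / 2 * β * τ) =
            A * X - ((A * X - a) / (A * X - A * x) + 1) / 2 * (A * X - A * x) := by
          rw [hxdef]; ring
        rw [e]
        have : ((A * X - a) / (A * X - A * x) + 1) / 2 * (A * X - A * x) =
            ((A * X - a) + (A * X - A * x)) / 2 := by
          linear_combination div_mul_cancel₀ (A * X - a) hpos.ne' / 2
        rw [this]; linarith
  have hmα : |m * α| < p := by
    have := abs_interpolate_lt (α₀ := 0) (by simpa using hp) hα hm0 hm1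
    simpa using this
  have hmβ : |m * β| < q := by
    have := abs_interpolate_lt (α₀ := 0) (by simpa using hq) hβ hm0 hm1
    simpa using this
  apply nonneg_of_forall_lt_one (A := B * (Y + m * α * τ + m * β * c) + C)
  intro k hk0 hk1
  have := h _ _ (abs_interpolate_lt hmα hα hk0 hk1) (abs_interpolate_lt hmβ hβ hk0 hk1) (by
    have e : A * (X + (m * α + k * (α - m * α)) * c - (m * β + k * (β - m * β)) * τ) =
      (1 - k) * (A * (X + m * α * c - m * β * τ)) + k * (A * x) := by rw [hxdef]; ring
    rw [e]; nlinarith)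
  calc 0 < _ := this
    _ = _ := by ring


/-- The door condition is only known on the line `x = a`, so the limit must be taken inside that
line. The strict bound on `|a - X|` provides an interior point of the box on it, from which to
interpolate. -/
theorem BoxSat.closed_door {p q X Y c τ a b : ℝ} (hp : 0 < p) (hq : 0 < q)
    (h : BoxSat p q X Y c τ (CorridorCond a b)) (hX : |a - X| < p * c + q * |τ|)
    {α β : ℝ} (hα : |α| ≤ p) (hβ : |β| ≤ q) (hx : X + α * c - β * τ = a) :
    0 ≤ Y + α * τ + β * c ∧ Y + α * τ + β * c ≤ b := by
  obtain ⟨e, he, heτ⟩ : ∃ e : ℝ, |e| = 1 ∧ e * τ = |τ| := by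
    rcases le_total 0 τ with h0 | h0
    · exact ⟨1, by simp, by rw [abs_of_nonneg h0]; ring⟩
    · exact ⟨-1, by simp, by rw [abs_of_nonpos h0]; ring⟩
  have hW : 0 < p * c + q * |τ| := (abs_nonneg _).trans_lt hX
  set k := (a - X) / (p * c + q * |τ|) with hk
  have hk1 : |k| < 1 := by rw [hk, abs_div, abs_of_pos hW, div_lt_one hW]; exact hX
  have hα0 : |k * p| < p := by rw [abs_mul, abs_of_pos hp]; nlinarith
  have hβ0 : |-(k * q * e)| < q := by rw [abs_neg, abs_mul, abs_mul, he, abs_of_pos hq]; nlinarith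
  have hx0 : X + k * p * c - -(k * q * e) * τ = a := by
    have : k * (p * c + q * |τ|) = a - X := by rw [hk]; field_simp
    rw [← heτ] at this
    linarith
  have key : ∀ m : ℝ, 0 ≤ m → m < 1 → _ := fun m hm0 hm1 =>
    (h _ _ (abs_interpolate_lt hα0 hα hm0 hm1) (abs_interpolate_lt hβ0 hβ hm0 hm1)).2 (by
      linear_combination (1 - m) * hx0 + m * hx)
  constructor
  · apply nonneg_of_forall_lt_one (A := Y + k * p * τ + -(k * q * e) * c)
    intro m hm0 hm1
    linarith [(key m hm0 hm1).1]
  · have : 0 ≤ b - (Y + α * τ + β * c) := by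
      apply nonneg_of_forall_lt_one (A := b - (Y + k * p * τ + -(k * q * e) * c))
      intro m hm0 hm1
      linarith [(key m hm0 hm1).2]
    linarith

/-- The line `x = a` meets both sides `β = ±q`; the two crossing points must lie between the ends of
the door. -/
theorem BoxSat.flat_section {p q X Y c τ a b : ℝ} (hp : 0 < p) (hq : 0 < q) (hc : 0 < c)
    (hcτ : c ^ 2 + τ ^ 2 = 1) (h : BoxSat p q X Y c τ (CorridorCond a b))
    (hX : |a - X| < p * c + q * |τ|) (hX' : |a - X| ≤ p * c - q * |τ|) :
    q ≤ Y * c + (a - X) * τ ∧ Y * c + (a - X) * τ ≤ b * c - q := by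
  have hτ2 := le_abs_self τ
  have hτ3 := neg_abs_le τ
  rw [abs_le] at hX'
  have h1 := (h.closed_door hp hq hX (α := (a - X - q * τ) / c) (β := -q) (by
    rw [abs_le, div_le_iff₀ hc, le_div_iff₀ hc]; constructor <;> nlinarith) (by
    rw [abs_neg, abs_of_pos hq]) (by field_simp; ring)).1
  have h2 := (h.closed_door hp hq hX (α := (a - X + q * τ) / c) (β := q) (by
    rw [abs_le, div_le_iff₀ hc, le_div_iff₀ hc]; constructor <;> nlinarith) (by
    rw [abs_of_pos hq]) (by field_simp; ring)).2
  have e1 : (Y + (a - X - q * τ) / c * τ + -q * c) * c = Y * c + (a - X) * τ - q := by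
    field_simp; linear_combination -q * hcτ
  have e2 : (Y + (a - X + q * τ) / c * τ + q * c) * c = Y * c + (a - X) * τ + q := by
    field_simp; linear_combination q * hcτ
  constructor
  · nlinarith
  · nlinarith

theorem BoxSat.flat_section_le {p q X Y c τ a b : ℝ} (hp : 0 < p) (hq : 0 < q) (hc : 0 < c)
    (hcτ : c ^ 2 + τ ^ 2 = 1) (h : BoxSat p q X Y c τ (CorridorCond a b))
    (hX : |a - X| < p * c + q * |τ|) (hX' : |a - X| ≤ p * c - q * |τ|) : 2 * q ≤ b * c := by
  have := h.flat_section hp hq hc hcτ hX hX'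
  linarith

theorem BoxSat.steep_section_le {p q X Y c τ a b : ℝ} (hp : 0 < p) (hq : 0 < q) (hc : 0 ≤ c)
    (hcτ : c ^ 2 + τ ^ 2 = 1) (h : BoxSat p q X Y c τ (CorridorCond a b))
    (hX : |a - X| < p * c + q * |τ|) (hX' : |a - X| ≤ q * |τ| - p * c) : 2 * p ≤ b * |τ| := by
  have hτ0 : 0 < |τ| := by
    rcases eq_or_ne τ 0 with h0 | h0
    · subst h0
      simp at hX hX' hcτ
      have := abs_nonneg (a - X)
      linarith
    · positivity
  have hτ : τ ≠ 0 := abs_pos.mp hτ0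
  have hsq : τ ^ 2 = |τ| ^ 2 := (sq_abs τ).symm
  have hβ : ∀ e : ℝ, |e| = 1 → |(X - a + e * p * c) / τ| ≤ q := by
    intro e he
    rw [abs_div, div_le_iff₀ hτ0]
    calc |X - a + e * p * c| ≤ |X - a| + |e * p * c| := abs_add_le _ _
      _ = |a - X| + p * c := by
        rw [abs_sub_comm, abs_mul, abs_mul, he, abs_of_pos hp, abs_of_nonneg hc]; ring
      _ ≤ _ := by linarith
  have h1 := h.closed_door hp hq hX (α := 1 * p) (β := (X - a + 1 * p * c) / τ) (by
    rw [one_mul, abs_of_pos hp]) (hβ 1 (by simp)) (by field_simp; ring)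
  have h2 := h.closed_door hp hq hX (α := -1 * p) (β := (X - a + -1 * p * c) / τ) (by
    rw [abs_mul]; simp [abs_of_pos hp]) (hβ (-1) (by simp)) (by field_simp; ring)
  have e1 : (Y + 1 * p * τ + (X - a + 1 * p * c) / τ * c) -
      (Y + -1 * p * τ + (X - a + -1 * p * c) / τ * c) = 2 * p / τ := by
    field_simp; linear_combination 2 * p * hcτ
  have h3 : |2 * p / τ| ≤ b := by rw [← e1, abs_le]; constructor <;> linarith [h1.1, h1.2, h2.1, h2.2]
  rw [abs_div, div_le_iff₀ hτ0] at h3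
  exact (le_abs_self _).trans h3

theorem BoxSat.closed_left_bottom {p q X Y c τ a : ℝ} (hp : 0 < p) (hq : 0 < q)
    (h : BoxSat p q X Y c τ fun x y => x < a → 0 < y) {α β : ℝ}
    (hα : |α| ≤ p) (hβ : |β| ≤ q) (hx : X + α * c - β * τ < a) : 0 ≤ Y + α * τ + β * c := by
  have h' : BoxSat p q X Y c τ fun x y => 1 * x < a → 0 < 1 * y + 0 := by simpa using h
  simpa using h'.closed_of_lt hp hq hα hβ (by simpa using hx)

theorem BoxSat.closed_right_bottom {p q X Y c τ a : ℝ} (hp : 0 < p) (hq : 0 < q)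
    (h : BoxSat p q X Y c τ fun x y => a < x → 0 < y) {α β : ℝ}
    (hα : |α| ≤ p) (hβ : |β| ≤ q) (hx : a < X + α * c - β * τ) : 0 ≤ Y + α * τ + β * c := by
  have h' : BoxSat p q X Y c τ fun x y => -1 * x < -a → 0 < 1 * y + 0 := fun α β h1 h2 h3 => by
    simpa using h α β h1 h2 (by linarith)
  simpa using h'.closed_of_lt hp hq hα hβ (by linarith)

theorem BoxSat.closed_right_top {p q X Y c τ a b : ℝ} (hp : 0 < p) (hq : 0 < q)
    (h : BoxSat p q X Y c τ fun x y => a < x → y < b) {α β : ℝ}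
    (hα : |α| ≤ p) (hβ : |β| ≤ q) (hx : a < X + α * c - β * τ) : Y + α * τ + β * c ≤ b := by
  have h' : BoxSat p q X Y c τ fun x y => -1 * x < -a → 0 < -1 * y + b := fun α β h1 h2 h3 => by
    have := h α β h1 h2 (by linarith)
    linarith
  linarith [h'.closed_of_lt hp hq hα hβ (by linarith)]

/-- The lower long side has height at least `0` at distance `G` past the door, hence at least `G |τ|
/ c` at the door. The section `2q / c` sits on top of it and ends below `b`. -/
theorem BoxSat.after_descending {p q X Y c τ a b : ℝ} (hp : 0 < p) (hq : 0 < q) (hc : 0 < c)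
    (hcτ : c ^ 2 + τ ^ 2 = 1) (h : BoxSat p q X Y c τ (CorridorCond a b))
    (hX : |a - X| < p * c + q * |τ|) (hX' : |a - X| ≤ p * c - q * |τ|)
    (hb : BoxSat p q X Y c τ fun x y => a < x → 0 < y) (hτ : τ ≤ 0)
    (hG : 0 < X + p * c - q * |τ| - a) :
    2 * q + (X + p * c - q * |τ| - a) * |τ| ≤ b * c := by
  have h1 := (h.flat_section hp hq hc hcτ hX hX').2
  rw [abs_of_nonpos hτ] at hG ⊢
  have h2 := hb.closed_right_bottom hp hq (α := p) (β := -q) (by rw [abs_of_pos hp])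
    (by rw [abs_neg, abs_of_pos hq]) (by linarith)
  have h3 := mul_nonneg h2 hc.le
  nlinarith

/-- Mirror image of `BoxSat.after_descending`, with the ceiling in place of the floor. -/
theorem BoxSat.after_ascending {p q X Y c τ a b : ℝ} (hp : 0 < p) (hq : 0 < q) (hc : 0 < c)
    (hcτ : c ^ 2 + τ ^ 2 = 1) (h : BoxSat p q X Y c τ (CorridorCond a b))
    (hX : |a - X| < p * c + q * |τ|) (hX' : |a - X| ≤ p * c - q * |τ|)
    (hb : BoxSat p q X Y c τ fun x y => a < x → y < b) (hτ : 0 ≤ τ)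
    (hG : 0 < X + p * c - q * |τ| - a) :
    2 * q + (X + p * c - q * |τ| - a) * |τ| ≤ b * c := by
  have h1 := (h.flat_section hp hq hc hcτ hX hX').1
  rw [abs_of_nonneg hτ] at hG ⊢
  have h2 := hb.closed_right_top hp hq (α := p) (β := q) (by rw [abs_of_pos hp])
    (by rw [abs_of_pos hq]) (by linarith)
  have h3 := mul_le_mul_of_nonneg_right h2 hc.le
  nlinarith

/-- The rear lower corner is above the floor; from there to the door the lower long side climbs with
slope `|τ| / c`, and the section `2q / c` must still fit below `b`. -/
theorem BoxSat.ascending_bound {p q X Y c τ a b : ℝ} (hp : 0 < p) (hq : 0 < q) (hc : 0 < c)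
    (hcτ : c ^ 2 + τ ^ 2 = 1) (h : BoxSat p q X Y c τ (CorridorCond a b))
    (hX : |a - X| < p * c - q * |τ|)
    (hb : BoxSat p q X Y c τ fun x y => x < a → 0 < y) (hτ : 0 ≤ τ) :
    |τ| * (2 * p * c - 2 * q * |τ| - (X + p * c - q * |τ| - a)) + 2 * q ≤ b * c := by
  have h1 := (h.flat_section hp hq hc hcτ
    (by have := mul_nonneg hq.le (abs_nonneg τ); linarith) hX.le).2
  rw [abs_of_nonneg hτ] at hX ⊢
  rw [abs_lt] at hX
  have h2 := hb.closed_left_bottom hp hq (α := -p) (β := -q) (by rw [abs_neg, abs_of_pos hp])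
    (by rw [abs_neg, abs_of_pos hq]) (by linarith)
  have h3 := mul_nonneg h2 hc.le
  nlinarith

/-- Same inequality as in `BoxSat.after_descending`, but now the front lower corner is left of the
door, so the floor on the left is what bounds it and the protrusion is negative. -/
theorem BoxSat.before_descending {p q X Y c τ a b : ℝ} (hp : 0 < p) (hq : 0 < q) (hc : 0 < c)
    (hcτ : c ^ 2 + τ ^ 2 = 1) (h : BoxSat p q X Y c τ (CorridorCond a b))
    (hb : BoxSat p q X Y c τ fun x y => x < a → 0 < y) (hτ : τ ≤ 0)
    (hG : X + p * c - q * |τ| - a < 0)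
    (hG0 : 0 < 2 * q * |τ| + (X + p * c - q * |τ| - a))
    (hG1 : 2 * q * |τ| ≤ 2 * p * c) :
    2 * q + (X + p * c - q * |τ| - a) * |τ| ≤ b * c := by
  have hpc := mul_pos hp hc
  have hX : |a - X| < p * c + q * |τ| := by rw [abs_lt]; constructor <;> linarith
  rw [abs_of_nonpos hτ] at hG hG0 hG1 ⊢
  have h2 := hb.closed_left_bottom hp hq (α := p) (β := -q) (by rw [abs_of_pos hp])
    (by rw [abs_neg, abs_of_pos hq]) (by linarith)
  have h3 := mul_nonneg h2 hc.le
  have h1 := (h.closed_door hp hq hX (α := (a - X + q * τ) / c) (β := q) (by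
    rw [abs_le, div_le_iff₀ hc, le_div_iff₀ hc]; constructor <;> linarith) (by
    rw [abs_of_pos hq]) (by field_simp; ring)).2
  have e2 : (Y + (a - X + q * τ) / c * τ + q * c) * c = Y * c + (a - X) * τ + q := by
    field_simp; linear_combination q * hcτ
  have h4 := mul_le_mul_of_nonneg_right h1 hc.le
  rw [e2] at h4
  nlinarith

/-- Climb from the floor along the lower long side, then back along the leading short side to the
line `x = a`, which must be reached below `b`. -/
theorem BoxSat.before_ascending {p q X Y c τ a b : ℝ} (hp : 0 < p) (hq : 0 < q) (hc : 0 < c)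
    (h : BoxSat p q X Y c τ (CorridorCond a b))
    (hb : BoxSat p q X Y c τ fun x y => x < a → 0 < y) (hτ : 0 < τ)
    (hG : X + p * c - q * |τ| - a < 0)
    (hG0 : 0 < 2 * q * |τ| + (X + p * c - q * |τ| - a))
    (hG1 : 2 * q * |τ| ≤ 2 * p * c) :
    2 * p * |τ| ^ 2 + 2 * q * c * |τ| + (X + p * c - q * |τ| - a) * c ≤ b * |τ| := by
  have hpc := mul_pos hp hc
  have hX : |a - X| < p * c + q * |τ| := by rw [abs_lt]; constructor <;> linarith
  rw [abs_of_pos hτ] at hG hG0 hG1 ⊢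
  have h2 := hb.closed_left_bottom hp hq (α := -p) (β := -q) (by rw [abs_neg, abs_of_pos hp])
    (by rw [abs_neg, abs_of_pos hq]) (by linarith)
  have h3 := mul_nonneg h2 hτ.le
  have h1 := (h.closed_door hp hq hX (α := p) (β := (X - a + p * c) / τ) (by
    rw [abs_of_pos hp]) (by
    rw [abs_le, div_le_iff₀ hτ, le_div_iff₀ hτ]; constructor <;> linarith)
    (by field_simp; ring)).2
  have e2 : (Y + p * τ + (X - a + p * c) / τ * c) * τ = Y * τ + p * τ ^ 2 + (X - a + p * c) * c := by
    field_simp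
  have h4 := mul_le_mul_of_nonneg_right h1 hτ.le
  rw [e2] at h4
  nlinarith

/-! ### Rigid motions and moving boxes in coordinates. -/

theorem exists_rigidMotion (x y e₀ e₁ f₀ f₁ : ℝ) (he : e₀ ^ 2 + e₁ ^ 2 = 1)
    (hf : f₀ ^ 2 + f₁ ^ 2 = 1) (hef : e₀ * f₀ + e₁ * f₁ = 0) :
    ∃ g : RigidMotion, ∀ p : Plane,
      g p = !₂[x + p 0 * e₀ + p 1 * f₀, y + p 0 * e₁ + p 1 * f₁] := by
  let T : Plane →ₗ[ℝ] Plane :=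
    { toFun := fun p => !₂[p 0 * e₀ + p 1 * f₀, p 0 * e₁ + p 1 * f₁]
      map_add' := fun p q => by
        ext i; fin_cases i <;> simp <;> ring
      map_smul' := fun r p => by
        ext i; fin_cases i <;> simp <;> ring }
  have hT : ∀ p, ‖T p‖ = ‖p‖ := fun p => by
    rw [EuclideanSpace.norm_eq, EuclideanSpace.norm_eq]
    congr 1
    simp only [T, Fin.sum_univ_two, Real.norm_eq_abs, sq_abs]
    simp
    linear_combination p 0 ^ 2 * he + p 1 ^ 2 * hf + 2 * p 0 * p 1 * hef
  let S : Plane →ₗᵢ[ℝ] Plane := ⟨T, hT⟩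
  refine ⟨(S.toLinearIsometryEquiv rfl).toAffineIsometryEquiv.trans
    (AffineIsometryEquiv.constVAdd ℝ Plane !₂[x, y]), fun p => ?_⟩
  have : ((S.toLinearIsometryEquiv rfl).toAffineIsometryEquiv.trans
    (AffineIsometryEquiv.constVAdd ℝ Plane !₂[x, y])) p = !₂[x, y] + T p := rfl
  rw [this]
  ext i; fin_cases i <;> simp [T] <;> ring

/-- A centred box is invariant under sign changes of its own coordinates, so `ε` and `δ` can absorb
reflections and make `c` nonnegative. Being an absolute value of a difference of coordinates, `c`
then varies continuously with the motion, whereas `τ` may jump in sign where `c = 0`; later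
arguments use only the continuity of `|τ|`. -/
theorem RigidMotion.exists_axes (g : RigidMotion) (m : Plane) :
    ∃ c τ ε δ : ℝ, ε ^ 2 = 1 ∧ δ ^ 2 = 1 ∧ c = |g (m + !₂[1, 0]) 0 - g m 0| ∧
      c ^ 2 + τ ^ 2 = 1 ∧ ∀ α β : ℝ, g (m + !₂[ε * α, δ * β]) =
        !₂[g m 0 + α * c - β * τ, g m 1 + α * τ + β * c] := by
  set l := g.linearIsometryEquiv
  have hadd : ∀ v, g (m + v) = l v + g m := fun v => by
    rw [add_comm m v]; exact g.map_vadd m v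
  have hl : ∀ u v : ℝ, l !₂[u, v] = u • l !₂[1, 0] + v • l !₂[0, 1] := fun u v => by
    rw [← map_smul, ← map_smul, ← map_add]
    congr 1
    ext i; fin_cases i <;> simp
  have hn : ∀ u v : ℝ, (l !₂[u, v] 0) ^ 2 + (l !₂[u, v] 1) ^ 2 = u ^ 2 + v ^ 2 := fun u v => by
    have h := l.norm_map !₂[u, v]
    have h2 : ‖l !₂[u, v]‖ ^ 2 = ‖(!₂[u, v] : Plane)‖ ^ 2 := by rw [h]
    rw [EuclideanSpace.real_norm_sq_eq, EuclideanSpace.real_norm_sq_eq, Fin.sum_univ_two,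
      Fin.sum_univ_two] at h2
    simpa using h2
  set e₀ := l !₂[1, 0] 0
  set e₁ := l !₂[1, 0] 1
  set f₀ := l !₂[0, 1] 0
  set f₁ := l !₂[0, 1] 1
  have he : e₀ ^ 2 + e₁ ^ 2 = 1 := by simpa using hn 1 0
  have hf : f₀ ^ 2 + f₁ ^ 2 = 1 := by simpa using hn 0 1
  have hef : e₀ * f₀ + e₁ * f₁ = 0 := by
    have h := hn 1 1
    rw [hl] at h
    simp only [one_smul, PiLp.add_apply] at h
    change (e₀ + f₀) ^ 2 + (e₁ + f₁) ^ 2 = 1 ^ 2 + 1 ^ 2 at h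
    linarith
  set κ := e₀ * f₁ - e₁ * f₀
  have hκ : κ ^ 2 = 1 := by
    linear_combination (f₀ ^ 2 + f₁ ^ 2) * he + hf - (e₀ * f₀ + e₁ * f₁) * hef
  have hf₀ : f₀ = -κ * e₁ := by linear_combination -f₀ * he + e₀ * hef
  have hf₁ : f₁ = κ * e₀ := by linear_combination -f₁ * he + e₁ * hef
  obtain ⟨ε, hε, hεe⟩ : ∃ ε : ℝ, ε ^ 2 = 1 ∧ |e₀| = ε * e₀ := by
    rcases le_total 0 e₀ with h0 | h0
    · exact ⟨1, by simp, by rw [abs_of_nonneg h0]; ring⟩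
    · exact ⟨-1, by simp, by rw [abs_of_nonpos h0]; ring⟩
  refine ⟨|e₀|, ε * e₁, ε, κ * ε, hε, by rw [mul_pow, hκ, hε, one_mul], ?_, ?_, fun α β => ?_⟩
  · congr 1
    rw [hadd]; simp [e₀]
  · rw [hεe]; linear_combination ε ^ 2 * he + hε
  · rw [hadd, hl, hεe]
    ext i; fin_cases i
    · change ε * α * e₀ + κ * ε * β * f₀ + g m 0 = g m 0 + α * (ε * e₀) - β * (ε * e₁)
      rw [hf₀]; linear_combination -ε * β * e₁ * hκ
    · change ε * α * e₁ + κ * ε * β * f₁ + g m 1 = g m 1 + α * (ε * e₁) + β * (ε * e₀)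
      rw [hf₁]; linear_combination ε * β * e₀ * hκ

/-- A continuous motion of a rectangle of sides `2p`, `2q`, in coordinates: `(X, Y)` is the centre
and `(c, τ)`, `(-τ, c)` are the axes. -/
structure BoxMotion (p q : ℝ) (A B C : Set Plane) where
  X : unitInterval → ℝ
  Y : unitInterval → ℝ
  c : unitInterval → ℝ
  τ : unitInterval → ℝ
  continuous_X : Continuous X
  continuous_c : Continuous c
  c_nonneg : ∀ t, 0 ≤ c t
  sq_add_sq : ∀ t, c t ^ 2 + τ t ^ 2 = 1
  start : BoxSat p q (X 0) (Y 0) (c 0) (τ 0) fun x y => !₂[x, y] ∈ A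
  finish : BoxSat p q (X 1) (Y 1) (c 1) (τ 1) fun x y => !₂[x, y] ∈ B
  inside : ∀ t, BoxSat p q (X t) (Y t) (c t) (τ t) fun x y => !₂[x, y] ∈ C

theorem CanMove.nonempty_boxMotion {R A B C : Set Plane} {L d : ℝ} (hR : IsOpenRectangle R L d)
    (h : CanMove R A B C) : Nonempty (BoxMotion (L / 2) (d / 2) A B C) := by
  obtain ⟨hL, hd, g, rfl⟩ := hR
  obtain ⟨Φ, hΦ, h0, h1, hC⟩ := h
  set m : Plane := !₂[L / 2, d / 2] with hm
  have hcont : ∀ p : Plane, Continuous fun t => Φ t (g p) := fun p =>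
    hΦ.comp (Continuous.prodMk continuous_id continuous_const)
  choose c τ ε δ hε hδ hc hcτ hbox using fun t => RigidMotion.exists_axes (g.trans (Φ t)) m
  have hsat : ∀ t S, Φ t '' (g '' openBox L d) ⊆ S →
      BoxSat (L / 2) (d / 2) (Φ t (g m) 0) (Φ t (g m) 1) (c t) (τ t) fun x y => !₂[x, y] ∈ S := by
    intro t S hS α β hα hβ
    have hab : ∀ ε : ℝ, ε ^ 2 = 1 → |ε| = 1 := fun ε h =>
      (pow_eq_one_iff_of_nonneg (abs_nonneg _) two_ne_zero).mp (by rwa [sq_abs])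
    have := hbox t α β
    simp only [AffineIsometryEquiv.coe_trans, Function.comp_apply] at this
    rw [← this]
    refine hS ⟨_, ⟨_, ?_, rfl⟩, rfl⟩
    have e1 : |ε t * α| < L / 2 := by rwa [abs_mul, hab _ (hε t), one_mul]
    have e2 : |δ t * β| < d / 2 := by rwa [abs_mul, hab _ (hδ t), one_mul]
    rw [abs_lt] at e1 e2
    simp only [openBox, hm, Set.mem_ofPred_eq]
    simp
    refine ⟨?_, ?_, ?_, ?_⟩ <;> linarith
  refine ⟨⟨fun t => Φ t (g m) 0, fun t => Φ t (g m) 1, c, τ, ?_, ?_, ?_, hcτ, hsat 0 A h0,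
    hsat 1 B h1, fun t => hsat t C (hC t)⟩⟩
  · have := hcont m
    fun_prop
  · have e : c = fun t => |Φ t (g (m + !₂[1, 0])) 0 - Φ t (g m) 0| := by
      funext t; rw [hc t]; rfl
    rw [e]
    have h1 := hcont m
    have h2 := hcont (m + !₂[1, 0])
    fun_prop
  · intro t; rw [hc t]; positivity

open Filter Topology

/-! ### Horizontal extent and the critical position. -/

theorem BoxSat.mono {p q X Y c τ : ℝ} {P Q : ℝ → ℝ → Prop} (h : BoxSat p q X Y c τ P)
    (hPQ : ∀ x y, P x y → Q x y) : BoxSat p q X Y c τ Q :=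
  fun α β hα hβ => hPQ _ _ (h α β hα hβ)

theorem BoxSat.extent_left {p q X Y c τ a : ℝ} (hp : 0 < p) (hq : 0 < q)
    (h : BoxSat p q X Y c τ fun x _ => a ≤ x) : a + (p * c + q * |τ|) ≤ X := by
  obtain ⟨e, he, heτ⟩ : ∃ e : ℝ, |e| = 1 ∧ e * τ = |τ| := by
    rcases le_total 0 τ with h0 | h0
    · exact ⟨1, by simp, by rw [abs_of_nonneg h0]; ring⟩
    · exact ⟨-1, by simp, by rw [abs_of_nonpos h0]; ring⟩
  have : 0 ≤ X - a - p * c - q * |τ| := by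
    apply nonneg_of_forall_lt_one_nonneg (A := X - a)
    intro k hk0 hk1
    have hp' : |-(k * p)| < p := by rw [abs_neg, abs_of_nonneg (by positivity)]; nlinarith
    have hq' : |k * q * e| < q := by
      rw [abs_mul, he, abs_of_nonneg (by positivity)]; nlinarith
    have := h _ _ hp' hq'
    rw [← heτ]
    linarith
  linarith

theorem BoxSat.extent_right {p q X Y c τ a : ℝ} (hp : 0 < p) (hq : 0 < q)
    (h : BoxSat p q X Y c τ fun x _ => x ≤ a) : X + (p * c + q * |τ|) ≤ a := by
  have h' : BoxSat p q (-X) Y c τ fun x _ => -a ≤ x := fun α β hα hβ => by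
    have := h (-α) (-β) (by rwa [abs_neg]) (by rwa [abs_neg])
    linarith
  linarith [h'.extent_left hp hq]

theorem BoxSat.left {p q X Y c τ a b : ℝ} (hp : 0 < p) (hq : 0 < q)
    (h : BoxSat p q X Y c τ (CorridorCond a b)) : p * c + q * |τ| ≤ X := by
  have h' : BoxSat p q X Y c τ fun x _ => 0 ≤ x := h.mono fun x y hxy => hxy.1.le
  linarith [h'.extent_left hp hq]

theorem one_le_add_abs {c τ : ℝ} (hc : 0 ≤ c) (h : c ^ 2 + τ ^ 2 = 1) : 1 ≤ c + |τ| := by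
  have := abs_nonneg τ
  have := sq_abs τ
  nlinarith [mul_nonneg hc (abs_nonneg τ)]

theorem abs_le_one_of_sq_add_sq {c τ : ℝ} (h : c ^ 2 + τ ^ 2 = 1) : |τ| ≤ 1 := by
  rw [← sq_le_one_iff_abs_le_one]; nlinarith [sq_nonneg c]

theorem le_one_of_sq_add_sq {c τ : ℝ} (h : c ^ 2 + τ ^ 2 = 1) : c ≤ 1 := by
  nlinarith [sq_nonneg τ]

/-- A box that blocks the door exactly, at the moment when the protruding part is a triangle. -/
theorem BoxSat.critical {p q X Y c τ a b : ℝ} (ha : 0 < a) (hp : 0 < p) (hq : 0 < q)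
    (hcτ : c ^ 2 + τ ^ 2 = 1) (h : BoxSat p q X Y c τ (CorridorCond a b))
    (harea : 2 * p * (2 * q) = a * b) (hpa : a < 2 * p) (hG : X + p * c - q * |τ| - a = 0)
    (hflat : q * |τ| < p * c) : 0 < c ∧ 0 < |τ| ∧ b * c = 2 * q ∧ 2 * p * c = a := by
  have hs := abs_nonneg τ
  have hc : 0 < c := by
    by_contra hc
    push Not at hc
    nlinarith [mul_nonneg hq.le hs, mul_nonneg hp.le (neg_nonneg.mpr hc)]
  have hleft := h.left hp hq
  have hτ : 0 < |τ| := by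
    rcases hs.eq_or_lt with h0 | h0
    · exfalso
      rw [← h0] at hleft hG
      have : τ = 0 := abs_eq_zero.mp h0.symm
      subst this
      have : c = 1 := by nlinarith
      subst this
      linarith
    · exact h0
  have hpos := mul_pos hq hτ
  have hsec := h.flat_section_le hp hq hc hcτ
    (by rw [abs_lt]; constructor <;> nlinarith [mul_pos hp hc])
    (by rw [abs_le]; constructor <;> linarith)
  have h1 : 2 * p * c ≤ a := by linarith
  -- The area identity turns `2 p c ≤ a` into the reverse of the section bound, so both are
  -- equalities.
  have h2 : a * (b * c) ≤ a * (2 * q) := by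
    calc a * (b * c) = 2 * p * c * (2 * q) := by linear_combination -c * harea
      _ ≤ a * (2 * q) := by gcongr
  have h3 : b * c = 2 * q := le_antisymm (le_of_mul_le_mul_left h2 ha) hsec
  refine ⟨hc, hτ, h3, ?_⟩
  have : 2 * q * (2 * p * c - a) = 0 := by linear_combination c * harea + a * h3
  rcases mul_eq_zero.mp this with h4 | h4 <;> linarith

/-- A section joining the two short sides has length at least `2p`, too long for the door. -/
theorem BoxSat.not_steep {p q X Y c τ a b : ℝ} (hb : 0 < b) (hp : 0 < p) (hq : 0 < q)
    (hc : 0 ≤ c) (hcτ : c ^ 2 + τ ^ 2 = 1) (h : BoxSat p q X Y c τ (CorridorCond a b))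
    (hpb : b < 2 * p) (hX : |a - X| < p * c + q * |τ|) : ¬ |a - X| ≤ q * |τ| - p * c := by
  intro h'
  have := h.steep_section_le hp hq hc hcτ hX h'
  nlinarith [abs_le_one_of_sq_add_sq hcτ]

/-! ### Obstructions to continuous motions. -/

section

variable {p q a b : ℝ} {A B C : Set Plane}

theorem BoxMotion.continuous_abs_τ (M : BoxMotion p q A B C) : Continuous fun t => |M.τ t| := by
  have : (fun t => |M.τ t|) = fun t => √(1 - M.c t ^ 2) := by
    funext t
    rw [← Real.sqrt_sq_eq_abs]
    congr 1
    linarith [M.sq_add_sq t]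
  rw [this]
  have := M.continuous_c
  fun_prop

/-- Signed protrusion of the box beyond the triangle of its rightmost corner. -/
def BoxMotion.protrusion (M : BoxMotion p q A B C) (a : ℝ) (t : unitInterval) : ℝ :=
  M.X t + p * M.c t - q * |M.τ t| - a

theorem BoxMotion.continuous_protrusion (M : BoxMotion p q A B C) : Continuous (M.protrusion a) := by
  have := M.continuous_X
  have := M.continuous_c
  have := M.continuous_abs_τ
  unfold BoxMotion.protrusion
  fun_prop

theorem BoxMotion.exists_blocking (M : BoxMotion p q A B C) (hp : 0 < p) (hq : 0 < q)
    (hA : ∀ x y, !₂[x, y] ∈ A → x ≤ a) (hB : ∀ x y, !₂[x, y] ∈ B → a ≤ x)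
    (hC : ∀ x y, !₂[x, y] ∈ C → CorridorCond a b x y) {k : ℝ} (hk0 : 0 ≤ k) (hk1 : k < 1) :
    ∃ c s : ℝ, 0 ≤ c ∧ 0 ≤ s ∧ c ≤ 1 ∧ s ≤ 1 ∧
      ((0 < c ∧ 2 * q ≤ b * c ∧ (1 + k) * (p * c) ≤ a) ∨
        (0 < s ∧ 2 * p ≤ b * s ∧ (1 + k) * (q * s) ≤ a)) := by
  have hcX := M.continuous_X
  have hcc := M.continuous_c
  have hcs := M.continuous_abs_τ
  -- `k = 1` would give the critical moment itself, but there the box may merely touch the door line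
  -- (when `c` or `τ` vanishes). Taking `k < 1` keeps the line `x = a` inside the open box.
  obtain ⟨t, ht⟩ : ∃ t, M.X t - a + k * |(p * M.c t - q * |M.τ t|)| = 0 := by
    have hbd : ∀ t, k * |(p * M.c t - q * |M.τ t|)| ≤ p * M.c t + q * |M.τ t| := fun t => by
      have h1 := mul_nonneg hp.le (M.c_nonneg t)
      have h2 := mul_nonneg hq.le (abs_nonneg (M.τ t))
      have h3 : |(p * M.c t - q * |M.τ t|)| ≤ p * M.c t + q * |M.τ t| := by
        rw [abs_le]; constructor <;> linarith
      nlinarith [abs_nonneg (p * M.c t - q * |M.τ t|)]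
    have h0 := (M.start.mono hA).extent_right hp hq
    have h1 := (M.finish.mono hB).extent_left hp hq
    refine mem_range_of_exists_le_of_exists_ge (by fun_prop) ⟨0, ?_⟩ ⟨1, ?_⟩
    · linarith [hbd 0]
    · have h1' := mul_nonneg hp.le (M.c_nonneg 1)
      have h2' := mul_nonneg hq.le (abs_nonneg (M.τ 1))
      have := mul_nonneg hk0 (abs_nonneg (p * M.c 1 - q * |M.τ 1|))
      linarith
  have h := (M.inside t).mono hC
  have hcτ := M.sq_add_sq t
  have hc := M.c_nonneg t
  have hs := abs_nonneg (M.τ t)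
  have h1 := mul_nonneg hp.le hc
  have h2 := mul_nonneg hq.le hs
  have hleft := h.left hp hq
  have hW : 0 < p * M.c t + q * |M.τ t| := by
    have := one_le_add_abs hc hcτ
    rcases hc.eq_or_lt with h0 | h0
    · have : 0 < |M.τ t| := by linarith
      positivity
    · positivity
  have habs : |a - M.X t| = k * |(p * M.c t - q * |M.τ t|)| := by
    rw [show a - M.X t = k * |(p * M.c t - q * |M.τ t|)| by linarith,
      abs_of_nonneg (mul_nonneg hk0 (abs_nonneg _))]
  refine ⟨M.c t, |M.τ t|, hc, hs, le_one_of_sq_add_sq hcτ, abs_le_one_of_sq_add_sq hcτ, ?_⟩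
  rcases le_total (q * |M.τ t|) (p * M.c t) with hle | hle
  · left
    have hc' : 0 < M.c t := by
      by_contra h0
      have : M.c t = 0 := le_antisymm (not_lt.mp h0) hc
      rw [this] at hle hW
      linarith
    rw [abs_of_nonneg (by linarith : 0 ≤ p * M.c t - q * |M.τ t|)] at habs ht
    refine ⟨hc', h.flat_section_le hp hq hc' hcτ (by nlinarith) (by nlinarith), ?_⟩
    nlinarith
  · right
    have hs' : 0 < |M.τ t| := by
      by_contra h0
      have : |M.τ t| = 0 := le_antisymm (not_lt.mp h0) hs
      rw [this] at hle hW
      linarith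
    rw [abs_of_nonpos (by linarith : p * M.c t - q * |M.τ t| ≤ 0)] at habs ht
    refine ⟨hs', h.steep_section_le hp hq hc hcτ (by nlinarith) (by nlinarith), ?_⟩
    nlinarith

theorem BoxMotion.area_le (M : BoxMotion p q A B C) (ha : 0 < a) (hp : 0 < p)
    (hq : 0 < q) (hA : ∀ x y, !₂[x, y] ∈ A → x ≤ a) (hB : ∀ x y, !₂[x, y] ∈ B → a ≤ x)
    (hC : ∀ x y, !₂[x, y] ∈ C → CorridorCond a b x y) : 2 * p * (2 * q) ≤ a * b := by
  have : 0 ≤ a * b - 2 * p * (2 * q) := by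
    apply nonneg_of_forall_lt_one_nonneg (A := a * b - 2 * p * q)
    intro k hk0 hk1
    obtain ⟨c, s, -, -, -, -, h | h⟩ := M.exists_blocking hp hq hA hB hC hk0 hk1
    · obtain ⟨hc, h1, h2⟩ := h
      have h3 := mul_le_mul h2 h1 (by positivity) ha.le
      have : c * ((1 + k) * (2 * p * q)) ≤ c * (a * b) := by linarith
      linarith [le_of_mul_le_mul_left this hc]
    · obtain ⟨hc, h1, h2⟩ := h
      have h3 := mul_le_mul h2 h1 (by positivity) ha.le
      have : s * ((1 + k) * (2 * p * q)) ≤ s * (a * b) := by linarith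
      linarith [le_of_mul_le_mul_left this hc]
  linarith

/-- The bound by `a` comes from the width of the box inside the strip at the start, the bound by `b`
from the section at a moment with `X = a`. -/
theorem BoxMotion.short_side_le (M : BoxMotion p q A B C) (hb : 0 < b) (hp : 0 < p)
    (hq : 0 < q) (hqp : q ≤ p)
    (hA : ∀ x y, !₂[x, y] ∈ A → x ≤ a) (hB : ∀ x y, !₂[x, y] ∈ B → a ≤ x)
    (hC : ∀ x y, !₂[x, y] ∈ C → CorridorCond a b x y) : 2 * q ≤ min a b := by
  apply le_min
  · have h0 := (M.start.mono hA).extent_right hp hq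
    have h1 := ((M.inside 0).mono hC).left hp hq
    have h2 := one_le_add_abs (M.c_nonneg 0) (M.sq_add_sq 0)
    nlinarith [M.c_nonneg 0]
  · obtain ⟨c, s, hc0, hs0, hc, hs, h | h⟩ := M.exists_blocking hp hq hA hB hC le_rfl one_pos
    · nlinarith
    · nlinarith

theorem BoxMotion.exists_last (M : BoxMotion p q A B C) (hb : 0 < b) (hp : 0 < p) (hq : 0 < q)
    (hA : ∀ x y, !₂[x, y] ∈ A → x ≤ a) (hB : ∀ x y, !₂[x, y] ∈ B → a ≤ x)
    (hC : ∀ x y, !₂[x, y] ∈ C → CorridorCond a b x y) (hpb : b < 2 * p) :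
    ∃ t₀, (𝓝[>] t₀).NeBot ∧ M.protrusion a t₀ = 0 ∧ q * |M.τ t₀| < p * M.c t₀ ∧
      ∀ᶠ t in 𝓝[>] t₀, 0 < M.protrusion a t := by
  have hcX := M.continuous_X
  have hcc := M.continuous_c
  have hcs := M.continuous_abs_τ
  -- `g t + a` is the abscissa of the second rightmost corner, whichever pair of sides is steeper.
  -- Its last nonpositive time is critical; a steep box would be caught in the door then or just
  -- after.
  set g : unitInterval → ℝ := fun t => M.X t - a + |(p * M.c t - q * |M.τ t|)| with hg
  have hgc : Continuous g := by fun_prop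
  have hpc := fun t => mul_nonneg hp.le (M.c_nonneg t)
  have hqs := fun t => mul_nonneg hq.le (abs_nonneg (M.τ t))
  have hW : ∀ t, 0 < p * M.c t + q * |M.τ t| := fun t => by
    have := one_le_add_abs (M.c_nonneg t) (M.sq_add_sq t)
    rcases (M.c_nonneg t).eq_or_lt with h0 | h0
    · have : 0 < |M.τ t| := by linarith
      have := hpc t
      positivity
    · have := hqs t
      positivity
  obtain ⟨t₀, ht₀, hmax⟩ := (isClosed_le hgc continuous_const).isCompact.exists_isGreatest
    (s := {t | g t ≤ 0}) ⟨0, by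
      have h0 := (M.start.mono hA).extent_right hp hq
      have : |(p * M.c 0 - q * |M.τ 0|)| ≤ p * M.c 0 + q * |M.τ 0| := by
        rw [abs_le]; constructor <;> linarith [hpc 0, hqs 0]
      change M.X 0 - a + |(p * M.c 0 - q * |M.τ 0|)| ≤ 0
      linarith⟩
  have ht₀' : g t₀ ≤ 0 := ht₀
  have hafter : ∀ t, t₀ < t → 0 < g t := fun t ht => by
    by_contra h
    exact absurd (hmax (not_lt.mp h : g t ≤ 0)) (not_le.mpr ht)
  have hlt : t₀ < 1 := by
    refine lt_of_le_of_ne unitInterval.le_one' fun h => ?_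
    have h1 := (M.finish.mono hB).extent_left hp hq
    rw [h] at ht₀'
    have := abs_nonneg (p * M.c 1 - q * |M.τ 1|)
    simp only [hg] at ht₀'
    linarith [hW 1]
  have hne : (𝓝[>] t₀).NeBot := nhdsGT_neBot_of_exists_gt ⟨1, hlt⟩
  have hev : ∀ᶠ t in 𝓝[>] t₀, 0 < g t := by
    filter_upwards [self_mem_nhdsWithin] with t ht using hafter t ht
  have hg0 : g t₀ = 0 := le_antisymm ht₀'
    (ge_of_tendsto (hgc.continuousAt.tendsto.mono_left nhdsWithin_le_nhds) (hev.mono fun _ h => h.le))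
  simp only [hg] at hg0
  rcases lt_trichotomy (p * M.c t₀) (q * |M.τ t₀|) with hlt' | heq | hgt
  · exfalso
    rw [abs_of_neg (by linarith)] at hg0
    have e1 : ∀ᶠ t in 𝓝[>] t₀, p * M.c t < q * |M.τ t| := nhdsWithin_le_nhds
      ((isOpen_lt (by fun_prop) (by fun_prop) :
        IsOpen {t | p * M.c t < q * |M.τ t|}).mem_nhds hlt')
    have e2 : ∀ᶠ t in 𝓝[>] t₀, M.X t - a < q * |M.τ t| - p * M.c t := nhdsWithin_le_nhds
      ((isOpen_lt (by fun_prop) (by fun_prop) :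
        IsOpen {t | M.X t - a < q * |M.τ t| - p * M.c t}).mem_nhds (by
          change M.X t₀ - a < q * |M.τ t₀| - p * M.c t₀; linarith))
    obtain ⟨t, h1, h2, h3⟩ := (e1.and (e2.and hev)).exists
    simp only [hg] at h3
    rw [abs_of_neg (by linarith)] at h3
    have hab : |a - M.X t| < q * |M.τ t| - p * M.c t := by rw [abs_lt]; constructor <;> linarith
    exact ((M.inside t).mono hC).not_steep hb hp hq (M.c_nonneg t) (M.sq_add_sq t) hpb
      (by linarith [hpc t]) hab.le
  · exfalso
    rw [heq, sub_self, abs_zero] at hg0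
    have hX : |a - M.X t₀| = 0 := by rw [abs_eq_zero]; linarith
    exact ((M.inside t₀).mono hC).not_steep hb hp hq (M.c_nonneg _) (M.sq_add_sq _) hpb
      (by rw [hX]; exact hW _) (by rw [hX, heq]; simp)
  · refine ⟨t₀, hne, ?_, hgt, ?_⟩
    · rw [abs_of_pos (by linarith)] at hg0
      unfold BoxMotion.protrusion
      linarith
    · have e1 : ∀ᶠ t in 𝓝[>] t₀, q * |M.τ t| < p * M.c t := nhdsWithin_le_nhds
        ((isOpen_lt (by fun_prop) (by fun_prop) :
          IsOpen {t | q * |M.τ t| < p * M.c t}).mem_nhds hgt)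
      filter_upwards [e1, hev] with t h1 h2
      simp only [hg] at h2
      rw [abs_of_pos (by linarith)] at h2
      unfold BoxMotion.protrusion
      linarith

theorem BoxMotion.exists_first (M : BoxMotion p q A B C) (hb : 0 < b) (hp : 0 < p) (hq : 0 < q)
    (hA : ∀ x y, !₂[x, y] ∈ A → x ≤ a) (hB : ∀ x y, !₂[x, y] ∈ B → a ≤ x)
    (hC : ∀ x y, !₂[x, y] ∈ C → CorridorCond a b x y) (hpa : a < 2 * p) (hpb : b < 2 * p) :
    ∃ t₀, (𝓝[<] t₀).NeBot ∧ M.protrusion a t₀ = 0 ∧ q * |M.τ t₀| < p * M.c t₀ ∧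
      ∀ᶠ t in 𝓝[<] t₀, M.protrusion a t < 0 := by
  have hcX := M.continuous_X
  have hcc := M.continuous_c
  have hcs := M.continuous_abs_τ
  have hgc := M.continuous_protrusion (a := a)
  have hpc := fun t => mul_nonneg hp.le (M.c_nonneg t)
  have hqs := fun t => mul_nonneg hq.le (abs_nonneg (M.τ t))
  obtain ⟨t₀, ht₀, hmin⟩ := (isClosed_le continuous_const hgc).isCompact.exists_isLeast
    (s := {t | 0 ≤ M.protrusion a t}) ⟨1, by
      have h1 := (M.finish.mono hB).extent_left hp hq
      change 0 ≤ M.X 1 + p * M.c 1 - q * |M.τ 1| - a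
      linarith [hpc 1]⟩
  have ht₀' : 0 ≤ M.protrusion a t₀ := ht₀
  have hbefore : ∀ t, t < t₀ → M.protrusion a t < 0 := fun t ht => by
    by_contra h
    exact absurd (hmin (not_lt.mp h : 0 ≤ M.protrusion a t)) (not_le.mpr ht)
  -- A nonnegative protrusion inside the initial strip would force `τ = 0`, hence `2p ≤ a`.
  have hlt : 0 < t₀ := by
    refine lt_of_le_of_ne unitInterval.nonneg' fun h => ?_
    have h1 := (M.start.mono hA).extent_right hp hq
    have h2 := ((M.inside 0).mono hC).left hp hq
    rw [← h] at ht₀'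
    unfold BoxMotion.protrusion at ht₀'
    have h3 : |M.τ 0| = 0 := by
      have : q * |M.τ 0| ≤ 0 := by linarith
      have h4 := abs_nonneg (M.τ 0)
      nlinarith
    have h5 := one_le_add_abs (M.c_nonneg 0) (M.sq_add_sq 0)
    rw [h3] at h1 h2 h5
    nlinarith [mul_nonneg hp.le (show 0 ≤ M.c 0 - 1 by linarith)]
  have hne : (𝓝[<] t₀).NeBot := nhdsLT_neBot_of_exists_lt ⟨0, hlt⟩
  have hev : ∀ᶠ t in 𝓝[<] t₀, M.protrusion a t < 0 := by
    filter_upwards [self_mem_nhdsWithin] with t ht using hbefore t ht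
  have hg0 : M.protrusion a t₀ = 0 := le_antisymm
    (le_of_tendsto (hgc.continuousAt.tendsto.mono_left nhdsWithin_le_nhds)
      (hev.mono fun _ h => h.le)) ht₀'
  refine ⟨t₀, hne, hg0, ?_, hev⟩
  by_contra! hle
  unfold BoxMotion.protrusion at hg0 hev
  have hs : 0 < q * |M.τ t₀| := by
    have := one_le_add_abs (M.c_nonneg t₀) (M.sq_add_sq t₀)
    rcases (M.c_nonneg t₀).eq_or_lt with h0 | h0
    · have : 0 < |M.τ t₀| := by linarith
      positivity
    · have := mul_pos hp h0
      linarith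
  rcases hle.eq_or_lt with heq | hlt'
  · have hX : |a - M.X t₀| = 0 := by rw [abs_eq_zero]; linarith
    exact ((M.inside t₀).mono hC).not_steep hb hp hq (M.c_nonneg _) (M.sq_add_sq _) hpb
      (by rw [hX]; linarith [hpc t₀]) (by rw [hX, heq]; simp)
  · have e2 : ∀ᶠ t in 𝓝[<] t₀, -(q * |M.τ t| - p * M.c t) < M.X t - a := nhdsWithin_le_nhds
      ((isOpen_lt (by fun_prop) (by fun_prop) :
        IsOpen {t | -(q * |M.τ t| - p * M.c t) < M.X t - a}).mem_nhds (by
          change -(q * |M.τ t₀| - p * M.c t₀) < M.X t₀ - a; linarith))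
    obtain ⟨t, h2, h3⟩ := (e2.and hev).exists
    have hab : |a - M.X t| < q * |M.τ t| - p * M.c t := by rw [abs_lt]; constructor <;> linarith
    exact ((M.inside t).mono hC).not_steep hb hp hq (M.c_nonneg t) (M.sq_add_sq t) hpb
      (by linarith [hpc t]) hab.le

/-- The hypothesis says `2q < h`; at the tilt with `b c = 2q` this is the sign of `a s - 2q`. -/
theorem lt_mul_of_narrow {a b q c s : ℝ} (ha : 0 < a) (hb : 0 < b) (hs : 0 ≤ s)
    (h : (2 * q) ^ 2 * (a ^ 2 + b ^ 2) < (a * b) ^ 2) (hcs : c ^ 2 + s ^ 2 = 1)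
    (hbc : b * c = 2 * q) : 2 * q < a * s := by
  have h1 : (2 * q) ^ 2 * b ^ 2 < (a * s) ^ 2 * b ^ 2 := by
    have e : (a * s) ^ 2 * b ^ 2 = (a * b) ^ 2 - a ^ 2 * (2 * q) ^ 2 := by
      rw [← hbc]; linear_combination a ^ 2 * b ^ 2 * hcs
    rw [e]; linarith
  have h2 := lt_of_mul_lt_mul_right h1 (by positivity)
  exact lt_of_pow_lt_pow_left₀ 2 (by positivity) h2

theorem mul_lt_of_wide {a b q c s : ℝ} (hb : 0 < b) (hq : 0 < q)
    (h : (a * b) ^ 2 < (2 * q) ^ 2 * (a ^ 2 + b ^ 2)) (hcs : c ^ 2 + s ^ 2 = 1)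
    (hbc : b * c = 2 * q) : a * s < 2 * q := by
  have h1 : (a * s) ^ 2 * b ^ 2 < (2 * q) ^ 2 * b ^ 2 := by
    have e : (a * s) ^ 2 * b ^ 2 = (a * b) ^ 2 - a ^ 2 * (2 * q) ^ 2 := by
      rw [← hbc]; linear_combination a ^ 2 * b ^ 2 * hcs
    rw [e]; linarith
  have h2 := lt_of_mul_lt_mul_right h1 (by positivity)
  exact lt_of_pow_lt_pow_left₀ 2 (by positivity) h2

theorem BoxMotion.protrusion_mul_nonpos (M : BoxMotion p q A B C) (ha : 0 < a) (hp : 0 < p)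
    (hq : 0 < q) (hC : ∀ x y, !₂[x, y] ∈ C → CorridorCond a b x y)
    (harea : 2 * p * (2 * q) = a * b) {t : unitInterval}
    (h : 2 * q + M.protrusion a t * |M.τ t| ≤ b * M.c t) :
    M.protrusion a t * (a * |M.τ t| - 2 * q) ≤ 0 := by
  have h1 : 2 * p * M.c t ≤ a + M.protrusion a t := by
    have := ((M.inside t).mono hC).left hp hq
    unfold BoxMotion.protrusion
    linarith
  have h2 := mul_le_mul_of_nonneg_right h1 (by positivity : 0 ≤ 2 * q)
  have h3 := mul_le_mul_of_nonneg_left h ha.le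
  have h4 : 2 * p * M.c t * (2 * q) = a * (b * M.c t) := by linear_combination M.c t * harea
  linarith

/-- The strict inequalities at the last critical moment survive for a short time, during which the
protrusion is positive. The final one contradicts `BoxSat.ascending_bound`. -/
theorem BoxMotion.exists_narrow_time (M : BoxMotion p q A B C) (ha : 0 < a) (hb : 0 < b)
    (hp : 0 < p) (hq : 0 < q)
    (hA : ∀ x y, !₂[x, y] ∈ A → x ≤ a) (hB : ∀ x y, !₂[x, y] ∈ B → a ≤ x)
    (hC : ∀ x y, !₂[x, y] ∈ C → CorridorCond a b x y) (harea : 2 * p * (2 * q) = a * b)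
    (hpa : a < 2 * p) (hpb : b < 2 * p)
    (hn : (2 * q) ^ 2 * (a ^ 2 + b ^ 2) < (a * b) ^ 2) :
    ∃ t, 0 < M.c t ∧ |a - M.X t| < p * M.c t - q * |M.τ t| ∧ 2 * q < a * |M.τ t| ∧
      0 < M.protrusion a t ∧
      b * M.c t < |M.τ t| * (2 * p * M.c t - 2 * q * |M.τ t| - M.protrusion a t) + 2 * q := by
  obtain ⟨t₀, hne, h0, hflat, hev⟩ := M.exists_last hb hp hq hA hB hC hpb
  obtain ⟨hc, hτ, hbc, hpc⟩ := ((M.inside t₀).mono hC).critical ha hp hq (M.sq_add_sq t₀) harea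
    hpa h0 hflat
  have hlt := lt_mul_of_narrow ha hb hτ.le hn (by rw [sq_abs]; exact M.sq_add_sq t₀) hbc
  have hcX := M.continuous_X
  have hcc := M.continuous_c
  have hcs := M.continuous_abs_τ
  have hcG := M.continuous_protrusion (a := a)
  have hopen : ∀ {f g : unitInterval → ℝ}, Continuous f → Continuous g → f t₀ < g t₀ →
      ∀ᶠ t in 𝓝[>] t₀, f t < g t := fun hf hg h =>
    nhdsWithin_le_nhds ((isOpen_lt hf hg).mem_nhds h)
  have e1 := hopen continuous_const hcc hc
  have e2 := hopen (f := fun t => M.X t - a) (g := fun t => p * M.c t - q * |M.τ t|)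
    (by fun_prop) (by fun_prop) (by
      unfold BoxMotion.protrusion at h0
      linarith)
  have e3 := hopen (f := fun _ => 2 * q) (g := fun t => a * |M.τ t|)
    (by fun_prop) (by fun_prop) hlt
  have e4 := hopen (f := fun t => b * M.c t)
    (g := fun t => |M.τ t| * (2 * p * M.c t - 2 * q * |M.τ t| - M.protrusion a t) + 2 * q)
    (by fun_prop) (by fun_prop) (by
      simp only [h0, hbc]
      have : 0 < 2 * p * M.c t₀ - 2 * q * |M.τ t₀| - 0 := by linarith
      have := mul_pos hτ this
      linarith)
  obtain ⟨t, h1, h2, h3, h4, h5⟩ := (e1.and (e2.and (e3.and (e4.and hev)))).exists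
  refine ⟨t, h1, ?_, h3, h5, h4⟩
  unfold BoxMotion.protrusion at h5
  rw [abs_lt]; constructor <;> linarith

/-- On the right the floor handles a descending box and the ceiling an ascending one. -/
theorem BoxMotion.not_narrow_of_strip (M : BoxMotion p q A B C) (ha : 0 < a) (hb : 0 < b)
    (hp : 0 < p) (hq : 0 < q)
    (hA : ∀ x y, !₂[x, y] ∈ A → x ≤ a) (hB : ∀ x y, !₂[x, y] ∈ B → a ≤ x)
    (hC : ∀ x y, !₂[x, y] ∈ C → CorridorCond a b x y) (harea : 2 * p * (2 * q) = a * b)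
    (hpa : a < 2 * p) (hpb : b < 2 * p)
    (hbot : ∀ x y, !₂[x, y] ∈ C → a < x → 0 < y) (htop : ∀ x y, !₂[x, y] ∈ C → a < x → y < b) :
    ¬ (2 * q) ^ 2 * (a ^ 2 + b ^ 2) < (a * b) ^ 2 := by
  intro hn
  obtain ⟨t, hc, hX, hs, hG, -⟩ := M.exists_narrow_time ha hb hp hq hA hB hC harea hpa hpb hn
  have h := (M.inside t).mono hC
  have hX' : |a - M.X t| < p * M.c t + q * |M.τ t| := by
    have := mul_nonneg hq.le (abs_nonneg (M.τ t))
    linarith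
  have key : 2 * q + M.protrusion a t * |M.τ t| ≤ b * M.c t := by
    rcases le_total (M.τ t) 0 with hτ | hτ
    · exact h.after_descending hp hq hc (M.sq_add_sq t) hX' hX.le ((M.inside t).mono hbot) hτ hG
    · exact h.after_ascending hp hq hc (M.sq_add_sq t) hX' hX.le ((M.inside t).mono htop) hτ hG
  have := M.protrusion_mul_nonpos ha hp hq hC harea key
  nlinarith

/-- Without a ceiling on the right, an ascending box is stopped by the floor on the left. -/
theorem BoxMotion.not_narrow_of_bottom (M : BoxMotion p q A B C) (ha : 0 < a) (hb : 0 < b)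
    (hp : 0 < p) (hq : 0 < q)
    (hA : ∀ x y, !₂[x, y] ∈ A → x ≤ a) (hB : ∀ x y, !₂[x, y] ∈ B → a ≤ x)
    (hC : ∀ x y, !₂[x, y] ∈ C → CorridorCond a b x y) (harea : 2 * p * (2 * q) = a * b)
    (hpa : a < 2 * p) (hpb : b < 2 * p)
    (hleft : ∀ x y, !₂[x, y] ∈ C → x < a → 0 < y)
    (hbot : ∀ x y, !₂[x, y] ∈ C → a < x → 0 < y) :
    ¬ (2 * q) ^ 2 * (a ^ 2 + b ^ 2) < (a * b) ^ 2 := by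
  intro hn
  obtain ⟨t, hc, hX, hs, hG, hup⟩ := M.exists_narrow_time ha hb hp hq hA hB hC harea hpa hpb hn
  have h := (M.inside t).mono hC
  have hX' : |a - M.X t| < p * M.c t + q * |M.τ t| := by
    have := mul_nonneg hq.le (abs_nonneg (M.τ t))
    linarith
  rcases le_total (M.τ t) 0 with hτ | hτ
  · have key : 2 * q + M.protrusion a t * |M.τ t| ≤ b * M.c t :=
      h.after_descending hp hq hc (M.sq_add_sq t) hX' hX.le ((M.inside t).mono hbot) hτ hG
    have := M.protrusion_mul_nonpos ha hp hq hC harea key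
    nlinarith
  · exact absurd (h.ascending_bound hp hq hc (M.sq_add_sq t) hX ((M.inside t).mono hleft) hτ)
      (not_le.mpr hup)

/-- Just before the first critical moment the protrusion is negative and `a |τ| < 2q`, contrary to
`BoxMotion.protrusion_mul_nonpos` if the box descends; an ascending box violates
`BoxSat.before_ascending`. -/
theorem BoxMotion.not_wide (M : BoxMotion p q A B C) (ha : 0 < a) (hb : 0 < b)
    (hp : 0 < p) (hq : 0 < q)
    (hA : ∀ x y, !₂[x, y] ∈ A → x ≤ a) (hB : ∀ x y, !₂[x, y] ∈ B → a ≤ x)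
    (hC : ∀ x y, !₂[x, y] ∈ C → CorridorCond a b x y) (harea : 2 * p * (2 * q) = a * b)
    (hpa : a < 2 * p) (hpb : b < 2 * p)
    (hleft : ∀ x y, !₂[x, y] ∈ C → x < a → 0 < y) :
    ¬ (a * b) ^ 2 < (2 * q) ^ 2 * (a ^ 2 + b ^ 2) := by
  intro hn
  obtain ⟨t₀, hne, h0, hflat, hev⟩ := M.exists_first hb hp hq hA hB hC hpa hpb
  obtain ⟨hc, hτ, hbc, hpc⟩ := ((M.inside t₀).mono hC).critical ha hp hq (M.sq_add_sq t₀) harea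
    hpa h0 hflat
  have hlt := mul_lt_of_wide hb hq hn (by rw [sq_abs]; exact M.sq_add_sq t₀) hbc
  have hcX := M.continuous_X
  have hcc := M.continuous_c
  have hcs := M.continuous_abs_τ
  have hcG := M.continuous_protrusion (a := a)
  have hopen : ∀ {f g : unitInterval → ℝ}, Continuous f → Continuous g → f t₀ < g t₀ →
      ∀ᶠ t in 𝓝[<] t₀, f t < g t := fun hf hg h =>
    nhdsWithin_le_nhds ((isOpen_lt hf hg).mem_nhds h)
  have e1 := hopen continuous_const hcc hc
  have e2 := hopen (f := fun t => q * |M.τ t|) (g := fun t => p * M.c t)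
    (by fun_prop) (by fun_prop) hflat
  have e3 := hopen (f := fun t => a * |M.τ t|) (g := fun _ => 2 * q)
    (by fun_prop) (by fun_prop) hlt
  have e4 := hopen (f := fun _ => 0) (g := fun t => 2 * q * |M.τ t| + M.protrusion a t)
    (by fun_prop) (by fun_prop) (by simp only [h0]; positivity)
  have e5 := hopen continuous_const hcs hτ
  -- At the critical moment this reduces to `q |τ| < p c`, so it still holds shortly before.
  have e6 := hopen (f := fun t => b * |M.τ t|) (g := fun t => 2 * p * |M.τ t| ^ 2 +
    2 * q * M.c t * |M.τ t| + M.protrusion a t * M.c t) (by fun_prop) (by fun_prop) (by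
      simp only [h0]
      have hsq : M.c t₀ ^ 2 + |M.τ t₀| ^ 2 = 1 := by rw [sq_abs]; exact M.sq_add_sq t₀
      have h1 : 0 < 2 * (p * M.c t₀ - q * |M.τ t₀|) * |M.τ t₀| := by
        have := sub_pos.mpr hflat
        positivity
      have h2 : b * M.c t₀ < (2 * p * |M.τ t₀| + 2 * q * M.c t₀) * M.c t₀ := by
        rw [hbc]; nlinarith
      have h3 := lt_of_mul_lt_mul_right h2 hc.le
      have h4 := mul_lt_mul_of_pos_right h3 hτ
      linarith)
  obtain ⟨t, h1, h2, h3, h4, h5, h6, hG⟩ :=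
    (e1.and (e2.and (e3.and (e4.and (e5.and (e6.and hev)))))).exists
  have h := (M.inside t).mono hC
  rcases le_or_gt (M.τ t) 0 with hτ' | hτ'
  · have key : 2 * q + M.protrusion a t * |M.τ t| ≤ b * M.c t :=
      h.before_descending hp hq h1 (M.sq_add_sq t) ((M.inside t).mono hleft) hτ' hG h4
        (by linarith)
    have := M.protrusion_mul_nonpos ha hp hq hC harea key
    nlinarith
  · exact absurd (h.before_ascending hp hq h1 ((M.inside t).mono hleft) hτ' hG h4 (by linarith))
      (not_le.mpr h6)

end

/-! ### Motions as paths of tilted boxes. -/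

/-- The open rectangle of sides `L`, `d` with corner `(w.1, w.2.1)`, turned clockwise by the angle
`w.2.2`. -/
def tiltedBox (L d : ℝ) (w : ℝ × ℝ × ℝ) : Set Plane :=
  {P | (0 < (P 0 - w.1) * Real.cos w.2.2 - (P 1 - w.2.1) * Real.sin w.2.2 ∧
      (P 0 - w.1) * Real.cos w.2.2 - (P 1 - w.2.1) * Real.sin w.2.2 < L) ∧
    0 < (P 0 - w.1) * Real.sin w.2.2 + (P 1 - w.2.1) * Real.cos w.2.2 ∧
      (P 0 - w.1) * Real.sin w.2.2 + (P 1 - w.2.1) * Real.cos w.2.2 < d}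

theorem exists_tilt (w : ℝ × ℝ × ℝ) : ∃ g : RigidMotion, ∀ p : Plane,
    g p = !₂[w.1 + p 0 * Real.cos w.2.2 + p 1 * Real.sin w.2.2,
      w.2.1 + p 0 * -Real.sin w.2.2 + p 1 * Real.cos w.2.2] :=
  exists_rigidMotion _ _ _ _ _ _ (by rw [neg_sq]; exact Real.cos_sq_add_sin_sq _)
    (Real.sin_sq_add_cos_sq _) (by ring)

/-- Constructing a motion becomes finding a path in the parameter space `ℝ³`; `g.symm` first brings
the given rectangle to standard position. -/
theorem canMove_of_joinedIn {R A B C : Set Plane} {L d : ℝ} (hR : IsOpenRectangle R L d)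
    {u v : ℝ × ℝ × ℝ} (h : JoinedIn {w | tiltedBox L d w ⊆ C} u v)
    (hu : tiltedBox L d u ⊆ A) (hv : tiltedBox L d v ⊆ B) : CanMove R A B C := by
  obtain ⟨-, -, g, rfl⟩ := hR
  obtain ⟨γ, hγ⟩ := h
  choose T hT using exists_tilt
  have himage : ∀ w S, tiltedBox L d w ⊆ S → g.symm.trans (T w) '' (g '' openBox L d) ⊆ S := by
    rintro w S hS _ ⟨_, ⟨p, hp, rfl⟩, rfl⟩
    apply hS
    obtain ⟨h1, h2, h3, h4⟩ := hp
    have e1 := Real.sin_sq_add_cos_sq w.2.2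
    simp only [AffineIsometryEquiv.coe_trans, Function.comp_apply,
      AffineIsometryEquiv.symm_apply_apply, hT]
    simp only [tiltedBox, Set.mem_ofPred_eq]
    simp
    have a1 : (p 0 * Real.cos w.2.2 + p 1 * Real.sin w.2.2) * Real.cos w.2.2 -
      (-(p 0 * Real.sin w.2.2) + p 1 * Real.cos w.2.2) * Real.sin w.2.2 = p 0 := by
      linear_combination p 0 * e1
    have a2 : (p 0 * Real.cos w.2.2 + p 1 * Real.sin w.2.2) * Real.sin w.2.2 +
      (-(p 0 * Real.sin w.2.2) + p 1 * Real.cos w.2.2) * Real.cos w.2.2 = p 1 := by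
      linear_combination p 1 * e1
    refine ⟨⟨?_, ?_⟩, ?_, ?_⟩ <;> linarith
  refine ⟨fun t => g.symm.trans (T (γ t)), ?_, ?_, ?_, fun t => himage _ _ (hγ t)⟩
  · simp only [AffineIsometryEquiv.coe_trans, Function.comp_apply, hT]
    have h1 : Continuous fun q : unitInterval × Plane => γ q.1 := by fun_prop
    have h2 : Continuous fun q : unitInterval × Plane => g.symm q.2 :=
      g.symm.continuous.comp continuous_snd
    fun_prop
  · simpa using himage _ _ hu
  · simpa using himage _ _ hv

theorem joinedIn_of_Icc {X : Type*} [TopologicalSpace X] {S : Set X} {F : ℝ → X} {r s : ℝ}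
    (hrs : r ≤ s) (hF : ContinuousOn F (Set.Icc r s)) (hS : ∀ t ∈ Set.Icc r s, F t ∈ S) :
    JoinedIn S (F r) (F s) := by
  have hmaps : Set.MapsTo (fun t => r + t * (s - r)) unitInterval (Set.Icc r s) := by
    rintro t ⟨h0, h1⟩
    constructor <;> nlinarith
  refine JoinedIn.ofLine (f := fun t => F (r + t * (s - r))) (hF.comp (by fun_prop) hmaps)
    (by simp) (by simp) ?_
  rintro _ ⟨t, ht, rfl⟩
  exact hS _ (hmaps ht)

/-! ### Membership, inclusions and symmetry of the corridors. -/

theorem mem_corridor_one_three {a b : ℝ} {P : Plane} (hx : 0 < P 0) (hy : 0 < P 1)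
    (h : a ≤ P 0 → P 1 < b) : P ∈ corridor a b 1 3 := by
  simp only [corridor, corridorA, corridorB, corridorA0, corridorB0, door, Set.mem_union,
    Set.mem_inter_iff, Set.mem_ofPred_eq]
  rcases lt_trichotomy (P 0) a with h1 | h1 | h1
  · tauto
  · have := h h1.ge
    tauto
  · have := h h1.le
    tauto

theorem mem_corridor_zero_three {a b : ℝ} {P : Plane} (hx : 0 < P 0)
    (h : a ≤ P 0 → 0 < P 1 ∧ P 1 < b) : P ∈ corridor a b 0 3 := by
  simp only [corridor, corridorA, corridorB, corridorA0, corridorB0, door, Set.mem_union,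
    Set.mem_inter_iff, Set.mem_ofPred_eq]
  rcases lt_trichotomy (P 0) a with h1 | h1 | h1
  · tauto
  · have := h h1.ge
    tauto
  · have := h h1.le
    tauto

theorem mem_corridor_one_two {a b : ℝ} {P : Plane} (hx : 0 < P 0)
    (h0 : P 0 ≤ a → 0 < P 1) (h : a ≤ P 0 → P 1 < b) : P ∈ corridor a b 1 2 := by
  simp only [corridor, corridorA, corridorB, corridorA0, corridorB0, door, Set.mem_union,
    Set.mem_inter_iff, Set.mem_ofPred_eq]
  rcases lt_trichotomy (P 0) a with h1 | h1 | h1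
  · have := h0 h1.le
    tauto
  · have := h h1.ge
    have := h0 h1.le
    tauto
  · have := h h1.le
    tauto

theorem corridorA_one_subset (a b : ℝ) (i : Fin 2) : corridorA a b 1 ⊆ corridorA a b i := by
  fin_cases i
  · exact Set.inter_subset_left
  · exact subset_rfl

theorem corridorA_subset_zero (a b : ℝ) (i : Fin 2) : corridorA a b i ⊆ corridorA a b 0 := by
  fin_cases i
  · exact subset_rfl
  · exact Set.inter_subset_left

theorem corridorB_three_subset (a b : ℝ) (j : Fin 4) : corridorB a b 3 ⊆ corridorB a b j := by
  rintro P ⟨h1, h2, h3⟩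
  fin_cases j
  · exact h1
  · exact ⟨h1, h2⟩
  · exact ⟨h1, h3⟩
  · exact ⟨h1, h2, h3⟩

theorem corridorB_subset_zero (a b : ℝ) (j : Fin 4) : corridorB a b j ⊆ corridorB a b 0 := by
  fin_cases j
  · exact subset_rfl
  all_goals exact Set.inter_subset_left

theorem CanMove.mono {R A A' B B' : Set Plane} (h : CanMove R A B (A ∪ B)) (hA : A ⊆ A')
    (hB : B ⊆ B') : CanMove R A' B' (A' ∪ B') := by
  obtain ⟨Φ, h1, h2, h3, h4⟩ := h
  exact ⟨Φ, h1, h2.trans hA, h3.trans hB, fun t => (h4 t).trans (Set.union_subset_union hA hB)⟩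

/-- The reflection `y ↦ b - y` preserves the door and `A₀` and exchanges `B₁` with `B₂`. -/
theorem CanMove.reflect {R : Set Plane} {a b : ℝ}
    (h : CanMove R (corridorA a b 0) (corridorB a b 2) (corridor a b 0 2)) :
    CanMove R (corridorA a b 0) (corridorB a b 1) (corridor a b 0 1) := by
  obtain ⟨Φ, h1, h2, h3, h4⟩ := h
  obtain ⟨ρ, hρ⟩ := exists_rigidMotion 0 b 1 0 0 (-1) (by norm_num) (by norm_num) (by norm_num)
  have hA : ∀ P ∈ corridorA a b 0, ρ P ∈ corridorA a b 0 := by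
    intro P hP
    simp only [corridorA, corridorA0, door, Set.mem_union, Set.mem_ofPred_eq] at hP ⊢
    simp only [hρ]
    simp
    rcases hP with ⟨e1, e2, e3⟩ | hP
    · exact Or.inl ⟨e1, e3, e2⟩
    · exact Or.inr hP
  have hB : ∀ P ∈ corridorB a b 2, ρ P ∈ corridorB a b 1 := by
    intro P hP
    simp only [corridorB, corridorB0, door, Set.mem_union, Set.mem_inter_iff,
      Set.mem_ofPred_eq] at hP ⊢
    simp only [hρ]
    simp
    rcases hP with ⟨⟨e1, e2, e3⟩ | hP, e4⟩
    · exact ⟨Or.inl ⟨e1, e3, e2⟩, e4⟩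
    · exact ⟨Or.inr hP, e4⟩
  refine ⟨fun t => (Φ t).trans ρ, ?_, ?_, ?_, ?_⟩
  · exact ρ.continuous.comp h1
  · rintro _ ⟨P, hP, rfl⟩
    exact hA _ (h2 ⟨P, hP, rfl⟩)
  · rintro _ ⟨P, hP, rfl⟩
    exact hB _ (h3 ⟨P, hP, rfl⟩)
  · rintro t _ ⟨P, hP, rfl⟩
    exact (h4 t ⟨P, hP, rfl⟩).imp (hA _) (hB _)

theorem add_mul_pos_of_sq {c s A B : ℝ} (hc : 0 ≤ c) (hs : 0 ≤ s) (h : s ^ 2 + c ^ 2 = 1)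
    (hA : 0 < A) (hB : 0 < B) : 0 < c * A + s * B := by
  rcases hc.eq_or_lt with h0 | h0
  · rcases hs.eq_or_lt with h1 | h1
    · rw [← h0, ← h1] at h; norm_num at h
    · positivity
  · positivity

/-! ### Admissible positions of tilted boxes. -/

section

variable {a b L d θ : ℝ}

/-- The box touching both axes stays below the corner `(a, b)`. -/
theorem tiltedBox_subset_corner (hc : 0 ≤ Real.cos θ) (hs : 0 ≤ Real.sin θ)
    (h : d + L * Real.sin θ * Real.cos θ ≤ a * Real.sin θ + b * Real.cos θ) :
    tiltedBox L d (0, L * Real.sin θ, θ) ⊆ corridor a b 1 3 := by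
  rintro P ⟨⟨h1, h2⟩, h3, h4⟩
  simp only at h1 h2 h3 h4
  have hcs := Real.sin_sq_add_cos_sq θ
  set c := Real.cos θ
  set s := Real.sin θ
  apply mem_corridor_one_three
  · have e := add_mul_pos_of_sq hc hs hcs h1 h3
    have : P 0 = c * ((P 0 - 0) * c - (P 1 - L * s) * s) + s * ((P 0 - 0) * s + (P 1 - L * s) * c) := by
      linear_combination -P 0 * hcs
    rwa [this]
  · have e := add_mul_pos_of_sq hs hc (by linarith) (sub_pos.mpr h2) h3
    have : P 1 = s * (L - ((P 0 - 0) * c - (P 1 - L * s) * s)) +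
        c * ((P 0 - 0) * s + (P 1 - L * s) * c) := by
      linear_combination (L * s - P 1) * hcs
    rwa [this]
  · intro hx
    by_contra! hy
    nlinarith [mul_le_mul_of_nonneg_right hx hs, mul_le_mul_of_nonneg_right hy hc]

/-- The box touching the left wall and the lower end of the door stays below the upper end. -/
theorem tiltedBox_subset_door (hc : 0 ≤ Real.cos θ) (hs : 0 < Real.sin θ)
    (h : d * Real.sin θ + L * Real.cos θ - a ≤ b * Real.cos θ * Real.sin θ) :
    tiltedBox L d (0, (L - a * Real.cos θ) / Real.sin θ, θ) ⊆ corridor a b 0 3 := by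
  rintro P ⟨⟨h1, h2⟩, h3, h4⟩
  simp only at h1 h2 h3 h4
  have hcs := Real.sin_sq_add_cos_sq θ
  set c := Real.cos θ
  set s := Real.sin θ
  set m := (L - a * c) / s with hm
  have hms : m * s = L - a * c := by rw [hm]; field_simp
  apply mem_corridor_zero_three
  · have e := add_mul_pos_of_sq hc hs.le hcs h1 h3
    have : P 0 = c * ((P 0 - 0) * c - (P 1 - m) * s) + s * ((P 0 - 0) * s + (P 1 - m) * c) := by
      linear_combination -P 0 * hcs
    rwa [this]
  · intro hx
    constructor
    · by_contra! hy
      nlinarith [mul_le_mul_of_nonneg_right hx hc, mul_nonneg (neg_nonneg.mpr hy) hs.le]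
    · by_contra! hy
      have h5 := mul_le_mul_of_nonneg_right hx hs.le
      have h6 := mul_le_mul_of_nonneg_right hy hc
      have h7 : a * s + (b - m) * c < d := by linarith
      have h8 := mul_lt_mul_of_pos_right h7 hs
      have h9 : (a * s + (b - m) * c) * s = a + b * c * s - L * c := by
        linear_combination a * hcs - c * hms
      linarith

/-- The strip that just fits into the door. -/
theorem tiltedBox_subset_slide (hc : 0 < Real.cos θ) (hs : 0 ≤ Real.sin θ)
    (hd : b * Real.cos θ = d) (hL : L * Real.cos θ = a) {k : ℝ} (hk : 0 ≤ k) :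
    tiltedBox L d (k * Real.cos θ, L * Real.sin θ - k * Real.sin θ, θ) ⊆ corridor a b 1 2 := by
  rintro P ⟨⟨h1, h2⟩, h3, h4⟩
  simp only at h1 h2 h3 h4
  have hcs := Real.sin_sq_add_cos_sq θ
  set c := Real.cos θ
  set s := Real.sin θ
  -- Since `L c = a`, the slide parameter drops out: the long sides stay on the parallel lines
  -- through the two ends of the door.
  have e3 : (P 0 - k * c) * s + (P 1 - (L * s - k * s)) * c = (P 0 - a) * s + P 1 * c := by
    linear_combination -s * hL
  rw [e3] at h3 h4
  apply mem_corridor_one_two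
  · have e := add_mul_pos_of_sq hc.le hs hcs h1 (e3 ▸ h3)
    have : P 0 = c * ((P 0 - k * c) * c - (P 1 - (L * s - k * s)) * s) +
        s * ((P 0 - k * c) * s + (P 1 - (L * s - k * s)) * c) + k * c := by
      linear_combination (-P 0 + k * c) * hcs
    rw [this]
    positivity
  · intro hx
    by_contra! hy
    nlinarith [mul_nonneg (sub_nonneg.mpr hx) hs, mul_nonneg (neg_nonneg.mpr hy) hc.le]
  · intro hx
    by_contra! hy
    nlinarith [mul_nonneg (sub_nonneg.mpr hx) hs, mul_le_mul_of_nonneg_right hy hc.le]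

theorem tiltedBox_subset_corridorB_two (hc : 0 < Real.cos θ) (hs : 0 ≤ Real.sin θ)
    (hd : b * Real.cos θ = d) (hL : L * Real.cos θ = a) {k : ℝ} (hk : a ≤ k * Real.cos θ)  :
    tiltedBox L d (k * Real.cos θ, L * Real.sin θ - k * Real.sin θ, θ) ⊆ corridorB a b 2 := by
  rintro P ⟨⟨h1, h2⟩, h3, h4⟩
  simp only at h1 h2 h3 h4
  have hcs := Real.sin_sq_add_cos_sq θ
  set c := Real.cos θ
  set s := Real.sin θ
  have e3 : (P 0 - k * c) * s + (P 1 - (L * s - k * s)) * c = (P 0 - a) * s + P 1 * c := by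
    linear_combination -s * hL
  have hx : a < P 0 := by
    have e := add_mul_pos_of_sq hc.le hs hcs h1 h3
    have : P 0 = c * ((P 0 - k * c) * c - (P 1 - (L * s - k * s)) * s) +
        s * ((P 0 - k * c) * s + (P 1 - (L * s - k * s)) * c) + k * c := by
      linear_combination (-P 0 + k * c) * hcs
    rw [this]
    linarith
  rw [e3] at h3 h4
  refine ⟨Or.inr hx, ?_⟩
  by_contra! hy
  have hy : b ≤ P 1 := by simpa using hy
  nlinarith [mul_nonneg (sub_nonneg.mpr hx.le) hs, mul_le_mul_of_nonneg_right hy hc.le]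

theorem tiltedBox_vertical_subset (hda : d ≤ a) :
    tiltedBox L d (0, L, Real.pi / 2) ⊆ corridorA a b 1 := by
  rintro P ⟨⟨h1, h2⟩, h3, h4⟩
  simp at h1 h2 h3 h4
  exact ⟨Or.inr ⟨h3, by linarith⟩, h2⟩

theorem joinedIn_horizontal (ha : 0 < a) (hdb : d ≤ b) :
    JoinedIn {w | tiltedBox L d w ⊆ corridor a b 1 3} (0, 0, 0) (a, 0, 0) := by
  refine joinedIn_of_Icc (F := fun k => (k, 0, 0)) ha.le (by fun_prop) ?_
  rintro k ⟨hk0, hk1⟩ P ⟨⟨h1, h2⟩, h3, h4⟩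
  simp at h1 h2 h3 h4
  exact mem_corridor_one_three (by linarith) h3 fun _ => by linarith

theorem tiltedBox_horizontal_subset (hdb : d ≤ b) :
    tiltedBox L d (a, 0, 0) ⊆ corridorB a b 3 := by
  rintro P ⟨⟨h1, h2⟩, h3, h4⟩
  simp at h1 h2 h3 h4
  exact ⟨Or.inr h1, h3, by linarith⟩

end

/-! ### Explicit motions. -/

section

variable {a b L d : ℝ} {R : Set Plane}

theorem joinedIn_corner {θ₁ θ₂ : ℝ} (h0 : 0 ≤ θ₁) (h12 : θ₁ ≤ θ₂) (h2 : θ₂ ≤ Real.pi / 2)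
    (h : ∀ θ ∈ Set.Icc θ₁ θ₂,
      d + L * Real.sin θ * Real.cos θ ≤ a * Real.sin θ + b * Real.cos θ) :
    JoinedIn {w | tiltedBox L d w ⊆ corridor a b 1 3} (0, L * Real.sin θ₁, θ₁)
      (0, L * Real.sin θ₂, θ₂) := by
  refine joinedIn_of_Icc (F := fun θ => (0, L * Real.sin θ, θ)) h12 (by fun_prop) ?_
  intro θ hθ
  exact tiltedBox_subset_corner
    (Real.cos_nonneg_of_neg_pi_div_two_le_of_le (by linarith [hθ.1, Real.pi_pos])
      (hθ.2.trans h2))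
    (Real.sin_nonneg_of_nonneg_of_le_pi (h0.trans hθ.1) (by linarith [hθ.2, Real.pi_pos]))
    (h θ hθ)

theorem joinedIn_door {θ₀ : ℝ} (h0 : 0 < θ₀) (h1 : θ₀ ≤ Real.pi / 2)
    (h : ∀ θ ∈ Set.Icc θ₀ (Real.pi / 2),
      d * Real.sin θ + L * Real.cos θ - a ≤ b * Real.cos θ * Real.sin θ) :
    JoinedIn {w | tiltedBox L d w ⊆ corridor a b 0 3}
      (0, (L - a * Real.cos θ₀) / Real.sin θ₀, θ₀) (0, L, Real.pi / 2) := by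
  have hsin : ∀ θ ∈ Set.Icc θ₀ (Real.pi / 2), 0 < Real.sin θ := fun θ hθ =>
    Real.sin_pos_of_pos_of_lt_pi (h0.trans_le hθ.1) (by linarith [hθ.2, Real.pi_pos])
  have := joinedIn_of_Icc (F := fun θ => ((0 : ℝ), (L - a * Real.cos θ) / Real.sin θ, θ))
    (S := {w | tiltedBox L d w ⊆ corridor a b 0 3}) h1
    (ContinuousOn.prodMk continuousOn_const (ContinuousOn.prodMk
      (ContinuousOn.div (by fun_prop) (by fun_prop) fun θ hθ => (hsin θ hθ).ne') continuousOn_id))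
    fun θ hθ => tiltedBox_subset_door
      (Real.cos_nonneg_of_neg_pi_div_two_le_of_le (by linarith [hθ.1, Real.pi_pos]) hθ.2)
      (hsin θ hθ) (h θ hθ)
  simpa using this

theorem joinedIn_slide {θ : ℝ} (ha : 0 < a) (hc : 0 < Real.cos θ) (hs : 0 ≤ Real.sin θ)
    (hd : b * Real.cos θ = d) (hL : L * Real.cos θ = a) :
    JoinedIn {w | tiltedBox L d w ⊆ corridor a b 1 2} (0, L * Real.sin θ, θ)
      (a / Real.cos θ * Real.cos θ, L * Real.sin θ - a / Real.cos θ * Real.sin θ, θ) := by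
  have := joinedIn_of_Icc
    (F := fun k => (k * Real.cos θ, L * Real.sin θ - k * Real.sin θ, θ))
    (S := {w | tiltedBox L d w ⊆ corridor a b 1 2}) (r := 0) (s := a / Real.cos θ)
    (by positivity) (by fun_prop) fun k hk => tiltedBox_subset_slide hc hs hd hL hk.1
  simpa using this

theorem corner_bound (hd : 0 < d) (hLd : L * d = a * b) {c s : ℝ}
    (h : 0 ≤ (b * c - d) * (d - a * s)) : d + L * s * c ≤ a * s + b * c := by
  have : 0 ≤ d * (a * s + b * c - (d + L * s * c)) := by
    -- The area relation makes the clearance under the corner `(a, b)` factor.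
    have e : d * (a * s + b * c - (d + L * s * c)) = (b * c - d) * (d - a * s) := by
      linear_combination -s * c * hLd
    rwa [e]
  have := nonneg_of_mul_nonneg_right this hd
  linarith

theorem door_bound (hd : 0 < d) (hLd : L * d = a * b) {c s : ℝ}
    (h : 0 ≤ (d - b * c) * (a - d * s)) : d * s + L * c - a ≤ b * c * s := by
  have : 0 ≤ d * (b * c * s - (d * s + L * c - a)) := by
    have e : d * (b * c * s - (d * s + L * c - a)) = (d - b * c) * (a - d * s) := by
      linear_combination -c * hLd
    rwa [e]
  have := nonneg_of_mul_nonneg_right this hd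
  linarith

/-- The angle at which a strip of width `d` just fits into the door. -/
theorem exists_fitting_angle (hb : 0 < b) (hd : 0 < d) (hdb : d < b)
    (hLd : L * d = a * b) : ∃ θ : ℝ, 0 < θ ∧ θ < Real.pi / 2 ∧ 0 < Real.cos θ ∧ 0 < Real.sin θ ∧
      b * Real.cos θ = d ∧ L * Real.cos θ = a ∧
      (a * Real.sin θ) ^ 2 * b ^ 2 = (a * b) ^ 2 - a ^ 2 * d ^ 2 := by
  have h1 : d / b < 1 := by rw [div_lt_one hb]; exact hdb
  have h0 : 0 < d / b := by positivity
  have hcos : Real.cos (Real.arccos (d / b)) = d / b := Real.cos_arccos (by linarith) h1.le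
  have hpos : 0 < Real.arccos (d / b) := Real.arccos_pos.mpr h1
  have hlt : Real.arccos (d / b) < Real.pi / 2 := Real.arccos_lt_pi_div_two.mpr h0
  have hbc : b * Real.cos (Real.arccos (d / b)) = d := by rw [hcos]; field_simp
  refine ⟨Real.arccos (d / b), hpos, hlt, by rw [hcos]; exact h0,
    Real.sin_pos_of_pos_of_lt_pi hpos (by linarith [Real.pi_pos]), hbc, ?_, ?_⟩
  · have : (L * Real.cos (Real.arccos (d / b)) - a) * b = 0 := by
      linear_combination L * hbc + hLd
    rcases mul_eq_zero.mp this with h | h <;> linarith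
  · have e := Real.sin_sq_add_cos_sq (Real.arccos (d / b))
    linear_combination a ^ 2 * b ^ 2 * e - a ^ 2 *
      (b * Real.cos (Real.arccos (d / b)) + d) * hbc

theorem JoinedIn.mono_corridor {S T : Set Plane} {u v : ℝ × ℝ × ℝ}
    (h : JoinedIn {w | tiltedBox L d w ⊆ S} u v) (hST : S ⊆ T) :
    JoinedIn {w | tiltedBox L d w ⊆ T} u v :=
  h.mono fun _ hw => Set.Subset.trans hw hST

theorem corridor_mono_right {i : Fin 2} {j : Fin 4} :
    corridor a b i 3 ⊆ corridor a b i j :=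
  Set.union_subset_union_right _ (corridorB_three_subset a b j)

theorem corridor_mono_left {i : Fin 2} {j : Fin 4} : corridor a b 1 j ⊆ corridor a b i j :=
  Set.union_subset_union_left _ (corridorA_one_subset a b i)

theorem canMove_rectangle (ha : 0 < a) (hR : IsOpenRectangle R a b) (i : Fin 2) (j : Fin 4) :
    CanMove R (corridorA a b i) (corridorB a b j) (corridor a b i j) := by
  refine CanMove.mono (canMove_of_joinedIn hR (joinedIn_horizontal ha le_rfl) ?_
    (tiltedBox_horizontal_subset le_rfl)) (corridorA_one_subset a b i)
    (corridorB_three_subset a b j)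
  rintro P ⟨⟨h1, h2⟩, h3, h4⟩
  simp at h1 h2 h3 h4
  exact ⟨Or.inr ⟨h1, h2⟩, h3⟩

theorem cos_le_cos_of_mem {θ₁ θ₂ : ℝ} (h1 : 0 ≤ θ₁) (h12 : θ₁ ≤ θ₂) (h2 : θ₂ ≤ Real.pi / 2) :
    Real.cos θ₂ ≤ Real.cos θ₁ :=
  Real.cos_le_cos_of_nonneg_of_le_pi h1 (by linarith [Real.pi_pos]) h12

theorem sin_le_sin_of_mem {θ₁ θ₂ : ℝ} (h1 : 0 ≤ θ₁) (h12 : θ₁ ≤ θ₂) (h2 : θ₂ ≤ Real.pi / 2) :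
    Real.sin θ₁ ≤ Real.sin θ₂ :=
  Real.sin_le_sin_of_le_of_le_pi_div_two (by linarith [Real.pi_pos]) h2 h12

/-- From the fitting angle up to the vertical, `b cos ≤ d ≤ a sin`, so both factors in
`corner_bound` are nonpositive. In the wide case both are nonnegative from the horizontal up to the
fitting angle. -/
theorem joinedIn_corner_of_narrow (hb : 0 < b) (hd : 0 < d) (ha : 0 < a) (hLd : L * d = a * b)
    (hn : d ^ 2 * (a ^ 2 + b ^ 2) ≤ (a * b) ^ 2) {θ : ℝ} (h0 : 0 < θ) (h1 : θ < Real.pi / 2)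
    (hs : 0 < Real.sin θ) (hbc : b * Real.cos θ = d)
    (hsq : (a * Real.sin θ) ^ 2 * b ^ 2 = (a * b) ^ 2 - a ^ 2 * d ^ 2) :
    JoinedIn {w | tiltedBox L d w ⊆ corridor a b 1 3} (0, L * Real.sin θ, θ)
      (0, L, Real.pi / 2) := by
  have has : d ≤ a * Real.sin θ := by
    have h2 : d ^ 2 * b ^ 2 ≤ (a * Real.sin θ) ^ 2 * b ^ 2 := by rw [hsq]; linarith
    exact le_of_sq_le_sq (le_of_mul_le_mul_right h2 (by positivity)) (by positivity)
  have := joinedIn_corner (a := a) (b := b) (L := L) (d := d) h0.le h1.le le_rfl fun φ hφ => by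
    apply corner_bound hd hLd
    have e1 := mul_le_mul_of_nonneg_left (cos_le_cos_of_mem h0.le hφ.1 hφ.2) hb.le
    have e2 := mul_le_mul_of_nonneg_left (sin_le_sin_of_mem h0.le hφ.1 hφ.2) ha.le
    nlinarith
  simpa using this

theorem joinedIn_corner_of_wide (hb : 0 < b) (hd : 0 < d) (ha : 0 < a) (hLd : L * d = a * b)
    (hw : (a * b) ^ 2 ≤ d ^ 2 * (a ^ 2 + b ^ 2)) {θ : ℝ} (h0 : 0 < θ) (h1 : θ < Real.pi / 2)
    (hbc : b * Real.cos θ = d)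
    (hsq : (a * Real.sin θ) ^ 2 * b ^ 2 = (a * b) ^ 2 - a ^ 2 * d ^ 2) :
    JoinedIn {w | tiltedBox L d w ⊆ corridor a b 1 3} (0, 0, 0) (0, L * Real.sin θ, θ) := by
  have has : a * Real.sin θ ≤ d := by
    have h2 : (a * Real.sin θ) ^ 2 * b ^ 2 ≤ d ^ 2 * b ^ 2 := by rw [hsq]; linarith
    exact le_of_sq_le_sq (le_of_mul_le_mul_right h2 (by positivity)) hd.le
  have := joinedIn_corner (a := a) (b := b) (L := L) (d := d) le_rfl h0.le h1.le fun φ hφ => by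
    apply corner_bound hd hLd
    have e1 := mul_le_mul_of_nonneg_left (cos_le_cos_of_mem hφ.1 hφ.2 h1.le) hb.le
    have e2 := mul_le_mul_of_nonneg_left (sin_le_sin_of_mem hφ.1 hφ.2 h1.le) ha.le
    nlinarith
  simpa using this

theorem joinedIn_door_of_fitting (hb : 0 < b) (hd : 0 < d) (hda : d ≤ a)
    (hLd : L * d = a * b) {θ : ℝ} (h0 : 0 < θ) (h1 : θ < Real.pi / 2) (hs : 0 < Real.sin θ)
    (hbc : b * Real.cos θ = d) (hLc : L * Real.cos θ = a) :
    JoinedIn {w | tiltedBox L d w ⊆ corridor a b 0 3} (0, L * Real.sin θ, θ)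
      (0, L, Real.pi / 2) := by
  have := joinedIn_door (a := a) (b := b) (L := L) (d := d) h0 h1.le fun φ hφ => by
    apply door_bound hd hLd
    have e1 := mul_le_mul_of_nonneg_left (cos_le_cos_of_mem h0.le hφ.1 hφ.2) hb.le
    have e2 := mul_le_mul_of_nonneg_left (Real.sin_le_one φ) hd.le
    exact mul_nonneg (by linarith) (by linarith)
  -- At the fitting angle the position pinned at the door is also the one touching both axes, so
  -- this turn can be followed by a slide or a corner turn.
  have e : (L - a * Real.cos θ) / Real.sin θ = L * Real.sin θ := by
    rw [div_eq_iff hs.ne', ← hLc]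
    linear_combination -L * Real.sin_sq_add_cos_sq θ
  rwa [e] at this

theorem canMove_one_two (ha : 0 < a) (hb : 0 < b) (hd : 0 < d) (hda : d ≤ a) (hdb : d < b)
    (hLd : L * d = a * b) (hn : d ^ 2 * (a ^ 2 + b ^ 2) ≤ (a * b) ^ 2)
    (hR : IsOpenRectangle R L d) :
    CanMove R (corridorA a b 1) (corridorB a b 2) (corridor a b 1 2) := by
  obtain ⟨θ, h0, h1, hc, hs, hbc, hLc, hsq⟩ := exists_fitting_angle hb hd hdb hLd
  exact canMove_of_joinedIn hR
    (((joinedIn_corner_of_narrow hb hd ha hLd hn h0 h1 hs hbc hsq).mono_corridor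
      corridor_mono_right).symm.trans (joinedIn_slide ha hc hs.le hbc hLc))
    (tiltedBox_vertical_subset hda)
    (tiltedBox_subset_corridorB_two hc hs.le hbc hLc (by rw [div_mul_cancel₀ _ hc.ne']))

theorem canMove_zero_two (ha : 0 < a) (hb : 0 < b) (hd : 0 < d) (hda : d ≤ a) (hdb : d < b)
    (hLd : L * d = a * b) (hR : IsOpenRectangle R L d) :
    CanMove R (corridorA a b 0) (corridorB a b 2) (corridor a b 0 2) := by
  obtain ⟨θ, h0, h1, hc, hs, hbc, hLc, hsq⟩ := exists_fitting_angle hb hd hdb hLd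
  exact canMove_of_joinedIn hR
    (((joinedIn_door_of_fitting hb hd hda hLd h0 h1 hs hbc hLc).mono_corridor
      corridor_mono_right).symm.trans
      ((joinedIn_slide ha hc hs.le hbc hLc).mono_corridor corridor_mono_left))
    ((tiltedBox_vertical_subset hda).trans (corridorA_one_subset a b 0))
    (tiltedBox_subset_corridorB_two hc hs.le hbc hLc (by rw [div_mul_cancel₀ _ hc.ne']))

theorem canMove_zero_three (ha : 0 < a) (hb : 0 < b) (hd : 0 < d) (hda : d ≤ a) (hdb : d < b)
    (hLd : L * d = a * b) (hw : (a * b) ^ 2 ≤ d ^ 2 * (a ^ 2 + b ^ 2))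
    (hR : IsOpenRectangle R L d) :
    CanMove R (corridorA a b 0) (corridorB a b 3) (corridor a b 0 3) := by
  obtain ⟨θ, h0, h1, hc, hs, hbc, hLc, hsq⟩ := exists_fitting_angle hb hd hdb hLd
  exact canMove_of_joinedIn hR
    ((joinedIn_door_of_fitting hb hd hda hLd h0 h1 hs hbc hLc).symm.trans
      (((joinedIn_corner_of_wide hb hd ha hLd hw h0 h1 hbc hsq).symm.trans
        (joinedIn_horizontal ha hdb.le)).mono_corridor corridor_mono_left))
    ((tiltedBox_vertical_subset hda).trans (corridorA_one_subset a b 0))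
    (tiltedBox_horizontal_subset hdb.le)

/-- For `d = h` the narrow and the wide corner turns are both available and meet at the fitting
angle. -/
theorem canMove_one_three (ha : 0 < a) (hb : 0 < b) (hd : 0 < d) (hda : d ≤ a) (hdb : d < b)
    (hLd : L * d = a * b) (he : d ^ 2 * (a ^ 2 + b ^ 2) = (a * b) ^ 2)
    (hR : IsOpenRectangle R L d) :
    CanMove R (corridorA a b 1) (corridorB a b 3) (corridor a b 1 3) := by
  obtain ⟨θ, h0, h1, hc, hs, hbc, hLc, hsq⟩ := exists_fitting_angle hb hd hdb hLd
  exact canMove_of_joinedIn hR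
    ((joinedIn_corner_of_narrow hb hd ha hLd he.le h0 h1 hs hbc hsq).symm.trans
      ((joinedIn_corner_of_wide hb hd ha hLd he.ge h0 h1 hbc hsq).symm.trans
        (joinedIn_horizontal ha hdb.le)))
    (tiltedBox_vertical_subset hda) (tiltedBox_horizontal_subset hdb.le)

/-! ### Area and change of sides. -/

theorem volume_openBox (c d : ℝ) (hc : 0 ≤ c) : volume (openBox c d) = ENNReal.ofReal (c * d) := by
  have h : openBox c d = (MeasurableEquiv.toLp 2 (Fin 2 → ℝ)).symm ⁻¹'
      (Set.univ.pi fun i => Set.Ioo ((![0, 0] : Fin 2 → ℝ) i) ((![c, d] : Fin 2 → ℝ) i)) := by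
    ext p
    simp [openBox, Set.mem_pi, Fin.forall_fin_two, and_assoc]
  rw [h, (EuclideanSpace.volume_preserving_symm_measurableEquiv_toLp (Fin 2)).measure_preimage_equiv,
    Real.volume_pi_Ioo, Fin.prod_univ_two]
  simp [ENNReal.ofReal_mul hc]

theorem RigidMotion.measurePreserving (g : RigidMotion) : MeasurePreserving g := by
  have h : (g : Plane → Plane) = (fun x => x + g 0) ∘ g.linearIsometryEquiv := by
    funext p
    have := g.map_vadd 0 p
    simpa using this
  rw [h]
  exact (measurePreserving_add_right volume (g 0)).comp g.linearIsometryEquiv.measurePreserving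

theorem IsOpenRectangle.volume_eq (hR : IsOpenRectangle R L d) :
    volume R = ENNReal.ofReal (L * d) := by
  obtain ⟨hL, -, g, rfl⟩ := hR
  rw [← volume_openBox L d hL.le]
  have h : g '' openBox L d = g.symm ⁻¹' openBox L d := g.toEquiv.image_eq_preimage_symm _
  rw [h]
  exact (RigidMotion.measurePreserving g.symm).measure_preimage_emb
    g.symm.toHomeomorph.measurableEmbedding _

theorem IsOpenRectangle.swap (hR : IsOpenRectangle R L d) : IsOpenRectangle R d L := by
  obtain ⟨hL, hd, g, rfl⟩ := hR
  obtain ⟨σ, hσ⟩ := exists_rigidMotion 0 0 0 1 1 0 (by norm_num) (by norm_num) (by norm_num)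
  refine ⟨hd, hL, σ.trans g, ?_⟩
  have hmem : ∀ p c d, p ∈ openBox c d → σ p ∈ openBox d c := by
    rintro p c d ⟨h1, h2, h3, h4⟩
    rw [hσ]
    simp [openBox, *]
  have hinv : ∀ p, σ (σ p) = p := fun p => by
    rw [hσ (σ p), hσ p]
    ext i; fin_cases i <;> simp
  ext P
  constructor
  · rintro ⟨p, hp, rfl⟩
    exact ⟨σ p, hmem _ _ _ hp, by simp [hinv]⟩
  · rintro ⟨p, hp, rfl⟩
    exact ⟨σ p, hmem _ _ _ hp, rfl⟩

/-! ### Pointwise conditions satisfied in the corridors. -/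

theorem corridorCond_of_mem {i : Fin 2} {j : Fin 4} (ha : 0 < a) (x y : ℝ)
    (h : !₂[x, y] ∈ corridor a b i j) : CorridorCond a b x y := by
  have h' : !₂[x, y] ∈ corridor a b 0 0 :=
    Set.union_subset_union (corridorA_subset_zero a b i) (corridorB_subset_zero a b j) h
  simp [corridor, corridorA, corridorB, corridorA0, corridorB0, door] at h'
  rcases h' with (h | h) | (h | h)
  · exact ⟨h.1 ▸ ha, fun _ => h.2⟩
  · exact ⟨h.1, fun e => absurd e h.2.ne⟩
  · exact ⟨h.1 ▸ ha, fun _ => h.2⟩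
  · exact ⟨ha.trans h, fun e => absurd e h.ne'⟩

theorem le_of_mem_corridorA {i : Fin 2} (x y : ℝ) (h : !₂[x, y] ∈ corridorA a b i) : x ≤ a := by
  have h' := corridorA_subset_zero a b i h
  simp [corridorA, corridorA0, door] at h'
  rcases h' with h | h
  · exact h.1.le
  · exact h.2.le

theorem le_of_mem_corridorB {j : Fin 4} (x y : ℝ) (h : !₂[x, y] ∈ corridorB a b j) : a ≤ x := by
  have h' := corridorB_subset_zero a b j h
  simp [corridorB, corridorB0, door] at h'
  rcases h' with h | h
  · exact h.1.ge
  · exact h.le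

theorem pos_of_mem_corridor_one {j : Fin 4} (x y : ℝ) (h : !₂[x, y] ∈ corridor a b 1 j)
    (hx : x < a) : 0 < y := by
  rcases h with h | h
  · simpa using h.2
  · exact absurd (le_of_mem_corridorB x y h) (not_le.mpr hx)

theorem pos_of_mem_corridor {i : Fin 2} {j : Fin 4} (hj : j = 1 ∨ j = 3) (x y : ℝ)
    (h : !₂[x, y] ∈ corridor a b i j) (hx : a < x) : 0 < y := by
  rcases h with h | h
  · exact absurd (le_of_mem_corridorA x y h) (not_le.mpr hx)
  · rcases hj with rfl | rfl
    · simpa using h.2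
    · have := h.2.1
      simpa using this

theorem lt_of_mem_corridor_three {i : Fin 2} (x y : ℝ) (h : !₂[x, y] ∈ corridor a b i 3)
    (hx : a < x) : y < b := by
  rcases h with h | h
  · exact absurd (le_of_mem_corridorA x y h) (not_le.mpr hx)
  · have := h.2.2
    simpa using this

/-! ### Maximal area and the sides of maximal rectangles. -/

theorem volume_le_of_movable (ha : 0 < a) {i : Fin 2} {j : Fin 4}
    (hR : R ∈ movableRectangles a b i j) : volume R ≤ ENNReal.ofReal (a * b) := by
  obtain ⟨⟨L, d, hR⟩, hmove⟩ := hR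
  obtain ⟨M⟩ := hmove.nonempty_boxMotion hR
  rw [hR.volume_eq]
  apply ENNReal.ofReal_le_ofReal
  have := M.area_le ha (half_pos hR.1) (half_pos hR.2.1) le_of_mem_corridorA le_of_mem_corridorB
    (corridorCond_of_mem ha)
  linarith

theorem isOpenRectangle_openBox (ha : 0 < a) (hb : 0 < b) : IsOpenRectangle (openBox a b) a b :=
  ⟨ha, hb, AffineIsometryEquiv.refl ℝ Plane, by simp⟩

theorem isGreatest_volume (ha : 0 < a) (hb : 0 < b) (i : Fin 2) (j : Fin 4) :
    IsGreatest ((fun R : Set Plane => volume R) '' movableRectangles a b i j)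
      (ENNReal.ofReal (a * b)) := by
  have h := isOpenRectangle_openBox ha hb
  refine ⟨⟨_, ⟨⟨a, b, h⟩, canMove_rectangle ha h i j⟩, h.volume_eq⟩, ?_⟩
  rintro _ ⟨R, hR, rfl⟩
  exact volume_le_of_movable ha hR

theorem mem_maxAreaRectangles (ha : 0 < a) {i : Fin 2} {j : Fin 4} (hR : IsOpenRectangle R L d)
    (hLd : L * d = a * b) (h : CanMove R (corridorA a b i) (corridorB a b j) (corridor a b i j)) :
    R ∈ maxAreaRectangles a b i j :=
  ⟨⟨⟨L, d, hR⟩, h⟩, fun _ hS => (volume_le_of_movable ha hS).trans_eq (by rw [hR.volume_eq, hLd])⟩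

theorem exists_sides_of_mem_maxAreaRectangles (ha : 0 < a) (hb : 0 < b) {i : Fin 2} {j : Fin 4}
    (hR : R ∈ maxAreaRectangles a b i j) : ∃ L d, IsOpenRectangle R L d ∧ L * d = a * b ∧
      d ≤ min a b ∧
      Nonempty (BoxMotion (L / 2) (d / 2) (corridorA a b i) (corridorB a b j)
        (corridor a b i j)) := by
  obtain ⟨⟨⟨L₀, d₀, hR₀⟩, hmove⟩, hmax⟩ := hR
  obtain ⟨L, d, hdL, hR⟩ : ∃ L d, d ≤ L ∧ IsOpenRectangle R L d := by
    rcases le_total d₀ L₀ with h | h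
    · exact ⟨L₀, d₀, h, hR₀⟩
    · exact ⟨d₀, L₀, h, hR₀.swap⟩
  obtain ⟨M⟩ := hmove.nonempty_boxMotion hR
  have hp := half_pos hR.1
  have hq := half_pos hR.2.1
  refine ⟨L, d, hR, ?_, ?_, ⟨M⟩⟩
  · have h := isOpenRectangle_openBox ha hb
    have h1 := hmax _ ⟨⟨a, b, h⟩, canMove_rectangle ha h i j⟩
    rw [h.volume_eq, hR.volume_eq, ENNReal.ofReal_le_ofReal_iff (mul_nonneg hR.1.le hR.2.1.le)]
      at h1
    have := M.area_le ha hp hq le_of_mem_corridorA le_of_mem_corridorB (corridorCond_of_mem ha)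
    linarith
  · have := M.short_side_le hb hp hq (by linarith) le_of_mem_corridorA le_of_mem_corridorB
      (corridorCond_of_mem ha)
    linarith

/-- Separates off the `a × b` rectangle, which always passes, so that the obstructions can assume
the long side exceeds both `a` and `b`. -/
theorem isOpenRectangle_or_lt (ha : 0 < a) (hb : 0 < b) (hR : IsOpenRectangle R L d)
    (hLd : L * d = a * b) (hd : d ≤ min a b) :
    IsOpenRectangle R a b ∨ (d < a ∧ d < b ∧ a < L ∧ b < L) := by
  have hd0 := hR.2.1
  rcases (le_min_iff.mp hd).1.eq_or_lt with rfl | h1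
  · left
    have : L = b := by
      have : (L - b) * d = 0 := by linarith
      rcases mul_eq_zero.mp this with h | h <;> linarith
    exact this ▸ hR.swap
  rcases (le_min_iff.mp hd).2.eq_or_lt with rfl | h2
  · left
    have : L = a := by
      have : (L - a) * d = 0 := by linarith
      rcases mul_eq_zero.mp this with h | h <;> linarith
    exact this ▸ hR
  · right
    exact ⟨h1, h2, by nlinarith, by nlinarith⟩

theorem le_div_sqrt_iff (ha : 0 < a) (hb : 0 < b) (hd : 0 < d) :
    d ≤ a * b / Real.sqrt (a ^ 2 + b ^ 2) ↔ d ^ 2 * (a ^ 2 + b ^ 2) ≤ (a * b) ^ 2 := by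
  have h : 0 < a ^ 2 + b ^ 2 := by positivity
  rw [le_div_iff₀ (Real.sqrt_pos.mpr h), ← sq_le_sq₀ (by positivity) (by positivity), mul_pow,
    Real.sq_sqrt h.le]

theorem div_sqrt_le_iff (ha : 0 < a) (hb : 0 < b) (hd : 0 < d) :
    a * b / Real.sqrt (a ^ 2 + b ^ 2) ≤ d ↔ (a * b) ^ 2 ≤ d ^ 2 * (a ^ 2 + b ^ 2) := by
  have h : 0 < a ^ 2 + b ^ 2 := by positivity
  rw [div_le_iff₀ (Real.sqrt_pos.mpr h), ← sq_le_sq₀ (by positivity) (by positivity),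
    mul_pow d, Real.sq_sqrt h.le]

theorem lt_of_narrow (ha : 0 < a) (hb : 0 < b) (hd : 0 < d)
    (hn : d ^ 2 * (a ^ 2 + b ^ 2) ≤ (a * b) ^ 2) : d < a ∧ d < b := by
  have h1 : 0 < d ^ 2 * b ^ 2 := by positivity
  have h2 : 0 < d ^ 2 * a ^ 2 := by positivity
  constructor
  · have : d ^ 2 * b ^ 2 < a ^ 2 * b ^ 2 := by linarith
    exact lt_of_pow_lt_pow_left₀ 2 ha.le (lt_of_mul_lt_mul_right this (by positivity))
  · have : d ^ 2 * a ^ 2 < b ^ 2 * a ^ 2 := by linarith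
    exact lt_of_pow_lt_pow_left₀ 2 hb.le (lt_of_mul_lt_mul_right this (by positivity))

theorem eq_div_of_area (hR : IsOpenRectangle R L d) (hLd : L * d = a * b) :
    IsOpenRectangle R (a * b / d) d := by
  have : a * b / d = L := by rw [div_eq_iff hR.2.1.ne', hLd]
  rwa [this]

/-! ### Classification of the maximal rectangles. -/

theorem canMove_zero {j : Fin 4} (hj : j = 0 ∨ j = 1 ∨ j = 2) (ha : 0 < a) (hb : 0 < b)
    (hd : 0 < d) (hdm : d ≤ min a b) (hLd : L * d = a * b) (hR : IsOpenRectangle R L d) :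
    CanMove R (corridorA a b 0) (corridorB a b j) (corridor a b 0 j) := by
  rcases isOpenRectangle_or_lt ha hb hR hLd hdm with h | ⟨h1, h2, -, -⟩
  · exact canMove_rectangle ha h 0 j
  · have h02 := canMove_zero_two ha hb hd h1.le h2 hLd hR
    rcases hj with rfl | rfl | rfl
    · exact h02.mono subset_rfl (corridorB_subset_zero a b 2)
    · exact h02.reflect
    · exact h02

theorem maxAreaRectangles_zero (ha : 0 < a) (hb : 0 < b) {j : Fin 4} (hj : j = 0 ∨ j = 1 ∨ j = 2) :
    maxAreaRectangles a b 0 j =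
      {R | ∃ d : ℝ, 0 < d ∧ d ≤ min a b ∧ IsOpenRectangle R (a * b / d) d} := by
  ext R
  constructor
  · intro hR
    obtain ⟨L, d, hR, hLd, hd, -⟩ := exists_sides_of_mem_maxAreaRectangles ha hb hR
    exact ⟨d, hR.2.1, hd, eq_div_of_area hR hLd⟩
  · rintro ⟨d, hd0, hd, hR⟩
    have hLd : a * b / d * d = a * b := div_mul_cancel₀ _ hd0.ne'
    exact mem_maxAreaRectangles ha hR hLd (canMove_zero hj ha hb hd0 hd hLd hR)

theorem maxAreaRectangles_zero_three (ha : 0 < a) (hb : 0 < b) :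
    maxAreaRectangles a b 0 3 =
      {R | ∃ d : ℝ, a * b / Real.sqrt (a ^ 2 + b ^ 2) ≤ d ∧ d ≤ min a b ∧
        IsOpenRectangle R (a * b / d) d} := by
  ext R
  constructor
  · intro hR
    obtain ⟨L, d, hR, hLd, hd, ⟨M⟩⟩ := exists_sides_of_mem_maxAreaRectangles ha hb hR
    refine ⟨d, ?_, hd, eq_div_of_area hR hLd⟩
    by_contra hn
    rw [div_sqrt_le_iff ha hb hR.2.1, not_le] at hn
    have hlt := lt_of_narrow ha hb hR.2.1 hn.le
    refine M.not_narrow_of_strip ha hb (half_pos hR.1) (half_pos hR.2.1) le_of_mem_corridorA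
      le_of_mem_corridorB (corridorCond_of_mem ha) (by linarith) ?_ ?_
      (pos_of_mem_corridor (Or.inr rfl)) lt_of_mem_corridor_three ?_
    · nlinarith [hR.2.1]
    · nlinarith [hR.2.1]
    · rwa [show 2 * (d / 2) = d by ring]
  · rintro ⟨d, hh, hd, hR⟩
    have hd0 := hR.2.1
    have hLd : a * b / d * d = a * b := div_mul_cancel₀ _ hd0.ne'
    refine mem_maxAreaRectangles ha hR hLd ?_
    rcases isOpenRectangle_or_lt ha hb hR hLd hd with h | ⟨h1, h2, -, -⟩
    · exact canMove_rectangle ha h 0 3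
    · exact canMove_zero_three ha hb hd0 h1.le h2 hLd ((div_sqrt_le_iff ha hb hd0).mp hh) hR

theorem isOpenRectangle_or_narrow (ha : 0 < a) (hb : 0 < b) {j : Fin 4}
    (hR : R ∈ maxAreaRectangles a b 1 j) : IsOpenRectangle R a b ∨
      ∃ L d, IsOpenRectangle R L d ∧ L * d = a * b ∧ d ^ 2 * (a ^ 2 + b ^ 2) ≤ (a * b) ^ 2 ∧
        (j = 1 ∨ j = 3 → d ^ 2 * (a ^ 2 + b ^ 2) = (a * b) ^ 2) := by
  obtain ⟨L, d, hR, hLd, hd, ⟨M⟩⟩ := exists_sides_of_mem_maxAreaRectangles ha hb hR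
  rcases isOpenRectangle_or_lt ha hb hR hLd hd with h | ⟨h1, h2, h3, h4⟩
  · exact Or.inl h
  · right
    have e : 2 * (d / 2) = d := by ring
    have hn : d ^ 2 * (a ^ 2 + b ^ 2) ≤ (a * b) ^ 2 := by
      have := M.not_wide ha hb (half_pos hR.1) (half_pos hR.2.1) le_of_mem_corridorA
        le_of_mem_corridorB (corridorCond_of_mem ha) (by linarith) (by linarith) (by linarith)
        pos_of_mem_corridor_one
      rwa [e, not_lt] at this
    refine ⟨L, d, hR, hLd, hn, fun hj => le_antisymm hn ?_⟩
    have := M.not_narrow_of_bottom ha hb (half_pos hR.1) (half_pos hR.2.1) le_of_mem_corridorA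
      le_of_mem_corridorB (corridorCond_of_mem ha) (by linarith) (by linarith) (by linarith)
      pos_of_mem_corridor_one (pos_of_mem_corridor hj)
    rwa [e, not_lt] at this

theorem maxAreaRectangles_one_of_unbounded (ha : 0 < a) (hb : 0 < b) {j : Fin 4}
    (hj : j = 0 ∨ j = 2) :
    maxAreaRectangles a b 1 j =
      {R | IsOpenRectangle R a b ∨
        ∃ d : ℝ, 0 < d ∧ d ≤ a * b / Real.sqrt (a ^ 2 + b ^ 2) ∧
          IsOpenRectangle R (a * b / d) d} := by
  ext R
  constructor
  · intro hR
    rcases isOpenRectangle_or_narrow ha hb hR with h | ⟨L, d, hR, hLd, hn, -⟩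
    · exact Or.inl h
    · exact Or.inr ⟨d, hR.2.1, (le_div_sqrt_iff ha hb hR.2.1).mpr hn, eq_div_of_area hR hLd⟩
  · rintro (hR | ⟨d, hd0, hh, hR⟩)
    · exact mem_maxAreaRectangles ha hR rfl (canMove_rectangle ha hR 1 j)
    · have hLd : a * b / d * d = a * b := div_mul_cancel₀ _ hd0.ne'
      have hn := (le_div_sqrt_iff ha hb hd0).mp hh
      have hlt := lt_of_narrow ha hb hd0 hn
      have h12 := canMove_one_two ha hb hd0 hlt.1.le hlt.2 hLd hn hR
      refine mem_maxAreaRectangles ha hR hLd ?_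
      rcases hj with rfl | rfl
      · exact h12.mono subset_rfl (corridorB_subset_zero a b 2)
      · exact h12

theorem maxAreaRectangles_one_of_bottom (ha : 0 < a) (hb : 0 < b) {j : Fin 4}
    (hj : j = 1 ∨ j = 3) :
    maxAreaRectangles a b 1 j =
      {R | IsOpenRectangle R a b ∨
        IsOpenRectangle R (Real.sqrt (a ^ 2 + b ^ 2))
          (a * b / Real.sqrt (a ^ 2 + b ^ 2))} := by
  have h : 0 < a ^ 2 + b ^ 2 := by positivity
  have hl := Real.sqrt_pos.mpr h
  ext R
  constructor
  · intro hR
    rcases isOpenRectangle_or_narrow ha hb hR with hab | ⟨L, d, hR, hLd, -, he⟩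
    · exact Or.inl hab
    · right
      have hd := hR.2.1
      have hdh : d = a * b / Real.sqrt (a ^ 2 + b ^ 2) :=
        le_antisymm ((le_div_sqrt_iff ha hb hd).mpr (he hj).le)
          ((div_sqrt_le_iff ha hb hd).mpr (he hj).ge)
      have hL : L = Real.sqrt (a ^ 2 + b ^ 2) := by
        rw [← mul_left_inj' hd.ne', hLd, hdh]
        field_simp
      rwa [← hdh, ← hL]
  · rintro (hR | hR)
    · exact mem_maxAreaRectangles ha hR rfl (canMove_rectangle ha hR 1 j)
    · have hd := hR.2.1
      have hLd : Real.sqrt (a ^ 2 + b ^ 2) * (a * b / Real.sqrt (a ^ 2 + b ^ 2)) = a * b := by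
        field_simp
      have he := le_antisymm ((le_div_sqrt_iff ha hb hd).mp le_rfl)
        ((div_sqrt_le_iff ha hb hd).mp le_rfl)
      have hlt := lt_of_narrow ha hb hd he.le
      exact mem_maxAreaRectangles ha hR hLd
        ((canMove_one_three ha hb hd hlt.1.le hlt.2 hLd he hR).mono subset_rfl
          (corridorB_three_subset a b j))

end

theorem corollary2 (a b : ℝ) (ha : 0 < a) (hb : 0 < b) :
    -- the maximum area is `a * b` in each of the eight corridors
    (∀ (i : Fin 2) (j : Fin 4),
      IsGreatest ((fun R : Set Plane => volume R) '' movableRectangles a b i j)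
        (ENNReal.ofReal (a * b))) ∧
    -- (i)
    (∀ j : Fin 4, j = 0 ∨ j = 1 ∨ j = 2 →
      maxAreaRectangles a b 0 j =
        {R | ∃ d : ℝ, 0 < d ∧ d ≤ min a b ∧ IsOpenRectangle R (a * b / d) d}) ∧
    -- (ii)
    (maxAreaRectangles a b 0 3 =
        {R | ∃ d : ℝ, a * b / Real.sqrt (a ^ 2 + b ^ 2) ≤ d ∧ d ≤ min a b ∧
          IsOpenRectangle R (a * b / d) d}) ∧
    -- (iii)
    (∀ j : Fin 4, j = 0 ∨ j = 2 →
      maxAreaRectangles a b 1 j =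
        {R | IsOpenRectangle R a b ∨
          ∃ d : ℝ, 0 < d ∧ d ≤ a * b / Real.sqrt (a ^ 2 + b ^ 2) ∧
            IsOpenRectangle R (a * b / d) d}) ∧
    -- (iv)
    (∀ j : Fin 4, j = 1 ∨ j = 3 →
      maxAreaRectangles a b 1 j =
        {R | IsOpenRectangle R a b ∨
          IsOpenRectangle R (Real.sqrt (a ^ 2 + b ^ 2))
            (a * b / Real.sqrt (a ^ 2 + b ^ 2))}) := by
  exact ⟨isGreatest_volume ha hb, fun _ hj => maxAreaRectangles_zero ha hb hj,
    maxAreaRectangles_zero_three ha hb,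
    fun _ hj => maxAreaRectangles_one_of_unbounded ha hb hj,
    fun _ hj => maxAreaRectangles_one_of_bottom ha hb hj⟩
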